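/- Let $F$ be a non-Archimedean local field of characteristic zero with ring of integers $\mathfrak o$, maximal ideal $\mathfrak p$, uniformizer $\varpi$ and normalized absolute value $|\cdot|_F$, let $\psi$ be an additive character of $F$ that is trivial on $\mathfrak o$ but not on $\varpi^{-1}\mathfrak o$, and let $n\ge 1$. Let $\pi$ be an irreducible smooth complex representation of $\mathrm{GL}_n(F)$ with contragredient $\widetilde\pi$ (the smooth vectors of the dual of $\pi$), and let $\varphi_{\widetilde\pi}$, with $\varphi_{\widetilde\pi}(\mathrm I_n)=1$, be a matrix coefficient of $\widetilde\pi$, i.e. an element of the linear span of the functions $g\mapsto\langle\widetilde\pi(g)\widetilde v,v\rangle$, $v\in\pi$, $\widetilde v\in\widetilde\pi$. Put $$\Phi_{\mathrm{GJ}}(g)=\psi(\mathrm{tr}\,g)\,|\det g|_F^{n/2},\qquad K_\ell=\mathrm I_n+\mathrm M_n(\mathfrak p^\ell),\qquad \mathfrak c_\ell=\mathrm{vol}(K_\ell)^{-1}\mathbf 1_{K_\ell}\qquad(\ell\ge 1),$$ $$(\Phi_{\mathrm{GJ}}*\mathfrak c_\ell^\vee)(g)=\int_{\mathrm{GL}_n(F)}\Phi_{\mathrm{GJ}}(h)\,\mathfrak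 c_\ell(g^{-1}h)\,dh ,$$ where $dh$ is a Haar measure on $\mathrm{GL}_n(F)$. For $x\in F^\times$ let $d_xg$ be the $\mathrm{SL}_n(F)$-invariant measure on the fiber $\{g\in\mathrm{GL}_n(F):\det g=x\}$ obtained by translating a fixed Haar measure of $\mathrm{SL}_n(F)$ by a point of the fiber (any normalization of the Haar measures is allowed). Then: 1. For every $\ell\ge1$ the convolution integral converges absolutely for every $g\in\mathrm{GL}_n(F)$, and the integral $$k_\ell(x)=\int_{\det g=x}(\Phi_{\mathrm{GJ}}*\mathfrak c_\ell^\vee)(g)\,\varphi_{\widetilde\pi}(g)\,d_xg$$ converges absolutely for every $x\in F^\times$. 2. For every $x\in F^\times$ the limit $k_{\pi,\psi}(x)=\lim_{\ell\to\infty}k_\ell(x)$ exists. Moreover, for every compact open set $\mathfrak n\subset F^\times$ there is $\ell_0$ such that $k_\ell(x)=k_{\pi,\psi}(x)$ for all $\ell\ge\ell_0$ and all $x\in\mathfrak n$. 3. The function $k_{\pi,\psi}$ is smooth, i.e. locally constant, on $F^\times$. -/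

import Mathlib

open MeasureTheory Filter Topology ValuativeRel

noncomputable section

namespace PiKernel

/-! Smooth representations, contragredients and matrix coefficients. -/

section Representations

variable {G : Type*} [Group G] [TopologicalSpace G] [IsTopologicalGroup G]
  {V : Type*} [AddCommGroup V] [Module ℂ V]

/-- The smooth vectors of a complex representation: those fixed by some open subgroup. -/
def smoothVectors (ρ : Representation ℂ G V) : Submodule ℂ V where
  carrier := {v | ∃ U : OpenSubgroup G, ∀ g ∈ U, ρ g v = v}
  zero_mem' := ⟨⊤, fun g _ => map_zero (ρ g)⟩
  add_mem' := by
    rintro v w ⟨U, hU⟩ ⟨U', hU'⟩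
    refine ⟨U ⊓ U', fun g hg => ?_⟩
    rw [map_add, hU g (OpenSubgroup.mem_inf.1 hg).1, hU' g (OpenSubgroup.mem_inf.1 hg).2]
  smul_mem' := by
    rintro c v ⟨U, hU⟩
    exact ⟨U, fun g hg => by rw [map_smul, hU g hg]⟩

/-- A representation is smooth if every vector is fixed by some open subgroup. -/
def IsSmoothRep (ρ : Representation ℂ G V) : Prop :=
  ∀ v : V, v ∈ smoothVectors ρ

theorem smoothVectors_invariant (ρ : Representation ℂ G V) (g : G) :
    smoothVectors ρ ≤ (smoothVectors ρ).comap (ρ g) := by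
  rintro v ⟨U, hU⟩
  refine ⟨U.comap (MulAut.conj g⁻¹).toMonoidHom ?_, fun h hh => ?_⟩
  · change Continuous fun h : G => g⁻¹ * h * g⁻¹⁻¹
    fun_prop
  · have h1 : g⁻¹ * h * g⁻¹⁻¹ ∈ U := hh
    have h2 := hU _ h1
    have h3 : h * g = g * (g⁻¹ * h * g⁻¹⁻¹) := by group
    calc ρ h (ρ g v) = ρ (h * g) v := by rw [map_mul]; rfl
      _ = ρ g (ρ (g⁻¹ * h * g⁻¹⁻¹) v) := by rw [h3, map_mul]; rfl
      _ = ρ g v := by rw [h2]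

/-- The contragredient of `ρ`: the action of `G` on the smooth vectors of the full linear
dual of `V`. -/
def contragredient (ρ : Representation ℂ G V) :
    Representation ℂ G (smoothVectors ρ.dual) :=
  ρ.dual.subrepresentation (smoothVectors ρ.dual) (smoothVectors_invariant ρ.dual)

/-- The space of matrix coefficients of the contragredient of `ρ`: the linear span of the
functions `g ↦ ⟨ρ^∨(g) w, v⟩`, for `v` in the space of `ρ` and `w` in the space of its
contragredient `ρ^∨`. -/
def contragredientCoeffs (ρ : Representation ℂ G V) : Submodule ℂ (G → ℂ) :=
  Submodule.span ℂ {f | ∃ (v : V) (w : smoothVectors ρ.dual),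
    f = fun g => (contragredient ρ g w : Module.Dual ℂ V) v}

end Representations

/-! Local fields and the general linear group. -/

section LocalField

variable {F : Type*} [Field F] [ValuativeRel F] [TopologicalSpace F]
  [IsNonarchimedeanLocalField F] {n : ℕ}

/-- The normalized absolute value on the nonzero elements: `|ϖ| = q⁻¹` for a uniformizer `ϖ`,
where `q` is the cardinality of the residue field. -/
def normAbs (x : Fˣ) : ℝ :=
  (Nat.card 𝓀[F] : ℝ) ^
    (WithZero.log (IsNonarchimedeanLocalField.valueGroupWithZeroIsoInt F (valuation F (x : F))))

/-- The additive character `ψ` is trivial on the ring of integers `𝒪`, but not on `ϖ⁻¹ 𝒪`. -/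
def IsUnramifiedChar (ψ : AddChar F Circle) : Prop :=
  (∀ a : 𝒪[F], ψ (a : F) = 1) ∧
    ∃ ϖ : 𝒪[F], Irreducible ϖ ∧ ∃ a : 𝒪[F], ψ ((ϖ : F)⁻¹ * (a : F)) ≠ 1

/-- The principal congruence subgroup `K_ℓ = I + M_n(𝔭^ℓ)` (for `1 ≤ ℓ`), as a set. -/
def congruenceSet (F : Type*) [Field F] [ValuativeRel F] [TopologicalSpace F]
    [IsNonarchimedeanLocalField F] (n ℓ : ℕ) : Set (GL (Fin n) F) :=
  {g | ∀ i j, ∃ a ∈ (𝓂[F] ^ ℓ : Ideal 𝒪[F]),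
    (g : Matrix (Fin n) (Fin n) F) i j - (1 : Matrix (Fin n) (Fin n) F) i j = (a : F)}

/-- The Godement-Jacquet kernel `Φ_GJ(g) = ψ(tr g) |det g|^{n/2}`. -/
def phiGJ (ψ : AddChar F Circle) (g : GL (Fin n) F) : ℂ :=
  (ψ (Matrix.trace (g : Matrix (Fin n) (Fin n) F)) : ℂ) *
    ((normAbs (Matrix.GeneralLinearGroup.det g) ^ ((n : ℝ) / 2) : ℝ) : ℂ)

/-- The function `𝔠_ℓ = vol(K_ℓ)⁻¹ 1_{K_ℓ}`. -/
def approxDelta [MeasurableSpace (GL (Fin n) F)] (μG : Measure (GL (Fin n) F)) (ℓ : ℕ) :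
    GL (Fin n) F → ℂ :=
  (congruenceSet F n ℓ).indicator fun _ => ((μG.real (congruenceSet F n ℓ))⁻¹ : ℂ)

/-- The function `ξ^∨(g) = ξ(g⁻¹)`. -/
def check {G : Type*} [Group G] (ξ : G → ℂ) : G → ℂ := fun g => ξ g⁻¹

/-- Convolution `(f₁ * f₂)(g) = ∫ f₁(h) f₂(h⁻¹ g) dh` of functions on a group. -/
def conv {G : Type*} [Group G] [MeasurableSpace G] (μ : Measure G) (f₁ f₂ : G → ℂ) : G → ℂ :=
  fun g => ∫ h, f₁ h * f₂ (h⁻¹ * g) ∂μ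

/-- The fiber of the determinant over `x`. -/
abbrev DetFiber (n : ℕ) (x : Fˣ) : Type _ :=
  {g : GL (Fin n) F // Matrix.GeneralLinearGroup.det g = x}

/-- The diagonal matrix `diag(x, 1, …, 1)`. -/
def diagElt (n : ℕ) [NeZero n] (x : Fˣ) : GL (Fin n) F :=
  Matrix.GeneralLinearGroup.mkOfDetNeZero
    (Matrix.diagonal (Function.update (fun _ => (1 : F)) (0 : Fin n) (x : F)))
    (by simp [Matrix.det_diagonal, Finset.prod_update_of_mem])

theorem det_diagElt [NeZero n] (x : Fˣ) :
    Matrix.GeneralLinearGroup.det (diagElt n x) = x := by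
  refine Units.ext ?_
  change Matrix.det (Matrix.diagonal (Function.update (fun _ => (1 : F)) (0 : Fin n) (x : F))) = x
  simp [Matrix.det_diagonal, Finset.prod_update_of_mem]

/-- The translation `h ↦ g₀ h` from `SL_n(F)` onto the fiber of the determinant through `g₀`. -/
def toFiber {x : Fˣ} (g₀ : DetFiber n x) (h : Matrix.SpecialLinearGroup (Fin n) F) :
    DetFiber n x :=
  ⟨g₀.1 * Matrix.SpecialLinearGroup.toGL h, by
    rw [map_mul, g₀.2]
    ext
    simp⟩

/-- The invariant measure `d_x g` on the fiber of the determinant over `x`: the transport of the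
Haar measure of `SL_n(F)` by the translation `h ↦ g₀ h`, where `g₀ = diag(x, 1, …, 1)`. By
invariance any other point `g₀` of the fiber gives the same measure
(see `map_toFiber_eq_fiberMeasure`). -/
def fiberMeasure [NeZero n] [MeasurableSpace (GL (Fin n) F)]
    [MeasurableSpace (Matrix.SpecialLinearGroup (Fin n) F)]
    (μS : Measure (Matrix.SpecialLinearGroup (Fin n) F)) (x : Fˣ) : Measure (DetFiber n x) :=
  μS.map (toFiber ⟨diagElt n x, det_diagElt x⟩)

theorem continuous_toFiber {x : Fˣ} (g₀ : DetFiber n x) : Continuous (toFiber g₀) := by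
  refine Continuous.subtype_mk (continuous_const.mul ?_) _
  refine Units.continuous_iff.2 ⟨?_, ?_⟩
  · exact continuous_subtype_val
  · have h : Continuous fun h : Matrix.SpecialLinearGroup (Fin n) F =>
        ((h⁻¹ : Matrix.SpecialLinearGroup (Fin n) F) : Matrix (Fin n) (Fin n) F) :=
      continuous_subtype_val.comp continuous_inv
    exact h

theorem map_toFiber_eq_fiberMeasure [NeZero n] [MeasurableSpace (GL (Fin n) F)]
    [BorelSpace (GL (Fin n) F)] [MeasurableSpace (Matrix.SpecialLinearGroup (Fin n) F)]
    [BorelSpace (Matrix.SpecialLinearGroup (Fin n) F)]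
    (μS : Measure (Matrix.SpecialLinearGroup (Fin n) F)) [μS.IsMulLeftInvariant] {x : Fˣ}
    (g₀ : DetFiber n x) : μS.map (toFiber g₀) = fiberMeasure μS x := by
  set d : DetFiber n x := ⟨diagElt n x, det_diagElt x⟩ with hd
  have hdet : Matrix.det ((d.1⁻¹ * g₀.1 : GL (Fin n) F) : Matrix (Fin n) (Fin n) F) = 1 := by
    have h : Matrix.GeneralLinearGroup.det (d.1⁻¹ * g₀.1) = 1 := by
      rw [map_mul, map_inv, d.2, g₀.2, inv_mul_cancel]
    exact congrArg Units.val h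
  let k : Matrix.SpecialLinearGroup (Fin n) F := ⟨_, hdet⟩
  have hk : Matrix.SpecialLinearGroup.toGL k = d.1⁻¹ * g₀.1 := Units.ext rfl
  have hcomp : toFiber g₀ = toFiber d ∘ fun h => k * h := by
    funext h
    refine Subtype.ext ?_
    change g₀.1 * _ = d.1 * Matrix.SpecialLinearGroup.toGL (k * h)
    rw [map_mul, hk]
    group
  rw [hcomp, ← Measure.map_map (continuous_toFiber d).measurable
    (continuous_const_mul k).measurable, map_mul_left_eq_self]
  rfl

/-- The integrand `(Φ_GJ * 𝔠_ℓ^∨)(g) φ(g)` of the fiber integral. -/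
def fiberIntegrand [MeasurableSpace (GL (Fin n) F)] (μG : Measure (GL (Fin n) F))
    (ψ : AddChar F Circle) (φ : GL (Fin n) F → ℂ) (ℓ : ℕ) (g : GL (Fin n) F) : ℂ :=
  conv μG (phiGJ ψ) (check (approxDelta μG ℓ)) g * φ g

/-- The fiber integral `∫_{det g = x} (Φ_GJ * 𝔠_ℓ^∨)(g) φ(g) d_x g`. -/
def fiberIntegral [NeZero n] [MeasurableSpace (GL (Fin n) F)]
    [MeasurableSpace (Matrix.SpecialLinearGroup (Fin n) F)] (μG : Measure (GL (Fin n) F))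
    (μS : Measure (Matrix.SpecialLinearGroup (Fin n) F))
    (ψ : AddChar F Circle) (φ : GL (Fin n) F → ℂ) (ℓ : ℕ) (x : Fˣ) : ℂ :=
  ∫ g : DetFiber n x, fiberIntegrand μG ψ φ ℓ g.1 ∂(fiberMeasure μS x)

/-- The kernel function `k(x)`: the regularized integral of `Φ_GJ φ` over the fiber `det g = x`,
that is, the limit of the fiber integrals as `ℓ → ∞`. -/
def kernel [NeZero n] [MeasurableSpace (GL (Fin n) F)]
    [MeasurableSpace (Matrix.SpecialLinearGroup (Fin n) F)] (μG : Measure (GL (Fin n) F))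
    (μS : Measure (Matrix.SpecialLinearGroup (Fin n) F))
    (ψ : AddChar F Circle) (φ : GL (Fin n) F → ℂ) (x : Fˣ) : ℂ :=
  limUnder atTop fun ℓ : ℕ => fiberIntegral μG μS ψ φ ℓ x

end LocalField

end PiKernel

end

/-! Convolution with `𝔠_ℓ^∨` averages `Φ_GJ` over the cosets `g K_ℓ`, and this is a truncation
(`conv_phiGJ`). If `g` has entries in `𝔭^{-ℓ}`, then `tr(gk) - tr g` is integral for `k ∈ K_ℓ` and
nothing changes; otherwise translation by a suitable element of `K_ℓ` multiplies the average by some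
`z ≠ 1`, so it vanishes. Hence `k_ℓ(x)` is the integral of `Φ_GJ φ` over a bounded part of the
fiber, which is compact because `SL_n` is closed in `M_n`.

For stability, `k_{ℓ+1}(x) - k_ℓ(x)` is the integral over the shell of matrices whose largest entry
has absolute value exactly `|ϖ|^{-(ℓ+1)}`. The coefficient `φ` is left invariant under some `K_m`.
Cut the shell into cosets `(K_r ∩ SL_n) g₀` with `r ≥ m` and `2r ≥ ℓ+1`. Up to integral errors `k ↦
tr(k g₀)` is additive in `k - 1`, so the coset integral vanishes as soon as some integral direction
`X` tangent to `SL_n` has `tr(X g₀) ∉ 𝔭^{-r}`. If there is none, `g₀` is scalar modulo `𝔭^{-r}`,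
which forces `|det g₀| = |ϖ|^{-n(ℓ+1)}`; this is impossible once `ℓ` is large compared with `|x|`
(`exists_trace_mul_gt`, `fiberIntegral_succ`).

The threshold for `ℓ` depends only on `m` and an upper bound for `|x|`, hence is uniform on compact
sets. Each `k_ℓ` is locally constant, since `diag(y/x, 1, …, 1)` lies in a small congruence subgroup
for `y` near `x`; so the limit is too. -/

namespace PiKernel

/-! ### Valuations, discreteness of the value group, and entrywise bounds on matrices. -/

section Valuations

variable {F : Type*} [Field F] [ValuativeRel F] [TopologicalSpace F]
  [IsNonarchimedeanLocalField F] {n : ℕ}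

theorem t2Space_of_isNonarchimedeanLocalField (F : Type*) [Field F] [ValuativeRel F]
    [TopologicalSpace F] [IsNonarchimedeanLocalField F] : T2Space F := by
  let := IsTopologicalAddGroup.rightUniformSpace F
  have := isUniformAddGroup_of_addCommGroup (G := F)
  infer_instance

theorem isOpen_valuation_sub_le (a : F) {c : ValueGroupWithZero F} (hc : c ≠ 0) :
    IsOpen {x : F | valuation F (x - a) ≤ c} := by
  obtain ⟨y, rfl⟩ := ValuativeRel.valuation_surjective c
  have h : IsOpen {x : F | (valuation F).restrict x ≤ (valuation F).restrict y} :=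
    Valuation.isOpen_closedBall (by simpa using hc)
  simp_rw [Valuation.restrict_le_iff] at h
  exact h.preimage (continuous_id.sub continuous_const)

section Uniformizer

variable {ϖ : 𝒪[F]} (hϖ : Irreducible ϖ)
include hϖ

omit [TopologicalSpace F] [IsNonarchimedeanLocalField F] in
theorem valuation_uniformizer_ne_zero : valuation F (ϖ : F) ≠ 0 := by
  rw [Valuation.ne_zero_iff]
  exact fun h => hϖ.ne_zero (Subtype.ext h)

theorem mem_maximalIdeal_pow_iff (ℓ : ℕ) (a : 𝒪[F]) :
    a ∈ (𝓂[F] ^ ℓ : Ideal 𝒪[F]) ↔ valuation F (a : F) ≤ valuation F (ϖ : F) ^ ℓ := by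
  rw [hϖ.maximalIdeal_eq, Ideal.span_singleton_pow, Ideal.mem_span_singleton,
    (Valuation.integer.integers (valuation F)).dvd_iff_le, map_pow, map_pow]
  exact Iff.rfl

theorem valuation_lt_one_iff (x : F) :
    valuation F x < 1 ↔ valuation F x ≤ valuation F (ϖ : F) := by
  have hlt : valuation F (ϖ : F) < 1 := by
    have h := hϖ.not_isUnit
    rw [(Valuation.integer.integers (valuation F)).isUnit_iff_valuation_eq_one] at h
    exact lt_of_le_of_ne ϖ.2 h
  refine ⟨fun h => ?_, fun h => h.trans_lt hlt⟩
  have hmem : (⟨x, h.le⟩ : 𝒪[F]) ∈ (𝓂[F] ^ 1 : Ideal 𝒪[F]) := by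
    rw [pow_one, IsLocalRing.mem_maximalIdeal, mem_nonunits_iff,
      (Valuation.integer.integers (valuation F)).isUnit_iff_valuation_eq_one]
    exact h.ne
  simpa using (mem_maximalIdeal_pow_iff hϖ 1 _).1 hmem

theorem valuation_uniformizer_lt_one : valuation F (ϖ : F) < 1 :=
  (valuation_lt_one_iff hϖ _).2 le_rfl

/-- The value group is discrete: a value greater than `c` is at least `|ϖ|⁻¹ c`. -/
theorem le_mul_valuation_of_lt {c : ValueGroupWithZero F} {x : F} (h : c < valuation F x) :
    c ≤ valuation F (ϖ : F) * valuation F x := by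
  obtain ⟨y, rfl⟩ := ValuativeRel.valuation_surjective c
  have hx : valuation F x ≠ 0 := (lt_of_le_of_lt zero_le h).ne'
  have h1 : valuation F (y / x) < 1 := by
    rw [map_div₀]
    exact (div_lt_one₀ (zero_lt_iff.2 hx)).2 h
  rw [valuation_lt_one_iff hϖ, map_div₀, div_le_iff₀ (zero_lt_iff.2 hx)] at h1
  exact h1

end Uniformizer

/-- All entries of the matrix have valuation at most `c`. -/
def EntriesLE (c : ValueGroupWithZero F) (A : Matrix (Fin n) (Fin n) F) : Prop :=
  ∀ i j, valuation F (A i j) ≤ c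

namespace EntriesLE

variable {c d : ValueGroupWithZero F} {A B : Matrix (Fin n) (Fin n) F}

omit [TopologicalSpace F] [IsNonarchimedeanLocalField F]

theorem mono (hA : EntriesLE c A) (h : c ≤ d) : EntriesLE d A := fun i j => (hA i j).trans h

theorem add (hA : EntriesLE c A) (hB : EntriesLE c B) : EntriesLE c (A + B) :=
  fun i j => Valuation.map_add_le _ (hA i j) (hB i j)

theorem neg (hA : EntriesLE c A) : EntriesLE c (-A) := fun i j => by
  rw [Matrix.neg_apply, Valuation.map_neg]
  exact hA i j

theorem mul (hA : EntriesLE c A) (hB : EntriesLE d B) : EntriesLE (c * d) (A * B) := fun i j => by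
  rw [Matrix.mul_apply]
  refine Valuation.map_sum_le _ fun k _ => ?_
  rw [map_mul]
  exact mul_le_mul' (hA i k) (hB k j)

theorem smul {s : F} (hs : valuation F s ≤ c) (hA : EntriesLE d A) : EntriesLE (c * d) (s • A) :=
  fun i j => by
    rw [Matrix.smul_apply, smul_eq_mul, map_mul]
    exact mul_le_mul' hs (hA i j)

theorem trace (hA : EntriesLE c A) : valuation F A.trace ≤ c :=
  Valuation.map_sum_le _ fun i _ => hA i i

theorem one : EntriesLE (1 : ValueGroupWithZero F) (1 : Matrix (Fin n) (Fin n) F) := fun i j => by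
  rw [Matrix.one_apply]
  split_ifs <;> simp

/-- Passing to a matrix over `𝒪[F]` makes adjugates and reduction to the residue field available. -/
theorem exists_map (hA : EntriesLE 1 A) :
    ∃ A' : Matrix (Fin n) (Fin n) 𝒪[F], 𝒪[F].subtype.mapMatrix A' = A :=
  ⟨Matrix.of fun i j => ⟨A i j, hA i j⟩, rfl⟩

theorem adjugate (hA : EntriesLE 1 A) : EntriesLE 1 A.adjugate := by
  obtain ⟨A', rfl⟩ := hA.exists_map
  rw [← RingHom.map_adjugate]
  exact fun i j => (A'.adjugate i j).2

end EntriesLE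

omit [TopologicalSpace F] [IsNonarchimedeanLocalField F] in
theorem exists_entriesLE (A : Matrix (Fin n) (Fin n) F) : ∃ c, EntriesLE c A :=
  ⟨Finset.univ.sup fun p : Fin n × Fin n => valuation F (A p.1 p.2), fun i j =>
    Finset.le_sup (f := fun p : Fin n × Fin n => valuation F (A p.1 p.2)) (Finset.mem_univ (i, j))⟩

/-- The determinant of an integral matrix that is congruent to a scalar unit modulo the maximal
ideal is a unit. -/
theorem valuation_det_eq_one {A : Matrix (Fin n) (Fin n) F} {c : F} (hc : valuation F c = 1)
    (h : ∀ i j, valuation F (A i j - (c • (1 : Matrix (Fin n) (Fin n) F)) i j) < 1) :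
    valuation F A.det = 1 := by
  have hA : EntriesLE 1 A := fun i j => by
    have h1 : valuation F ((c • (1 : Matrix (Fin n) (Fin n) F)) i j) ≤ 1 := by
      simpa using EntriesLE.smul hc.le EntriesLE.one i j
    simpa using Valuation.map_add_le _ (h i j).le h1
  obtain ⟨A', rfl⟩ := hA.exists_map
  let c' : 𝒪[F] := ⟨c, hc.le⟩
  have hint := Valuation.integer.integers (valuation F)
  -- Over the residue field the matrix becomes a nonzero scalar, whose determinant is a nonzero
  -- power.
  have hres : (IsLocalRing.residue 𝒪[F]).mapMatrix A' =
      IsLocalRing.residue 𝒪[F] c' • (1 : Matrix (Fin n) (Fin n) 𝓀[F]) := by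
    ext i j
    have h0 : A' i j - (c' • (1 : Matrix (Fin n) (Fin n) 𝒪[F])) i j ∈
        IsLocalRing.maximalIdeal 𝒪[F] := by
      rw [IsLocalRing.mem_maximalIdeal, mem_nonunits_iff, hint.isUnit_iff_valuation_eq_one]
      refine ne_of_lt ?_
      convert h i j using 2
      by_cases hij : i = j <;> simp [hij, c', Subring.subtype] <;> rfl
    rw [← IsLocalRing.residue_eq_zero_iff, map_sub, sub_eq_zero] at h0
    rw [RingHom.mapMatrix_apply, Matrix.map_apply, h0]
    by_cases hij : i = j <;> simp [hij]
  have hdet : IsLocalRing.residue 𝒪[F] A'.det ≠ 0 := by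
    rw [RingHom.map_det, hres, Matrix.det_smul, Matrix.det_one, mul_one]
    refine pow_ne_zero _ ?_
    rw [IsLocalRing.residue_ne_zero_iff_isUnit, hint.isUnit_iff_valuation_eq_one]
    exact hc
  rw [IsLocalRing.residue_ne_zero_iff_isUnit, hint.isUnit_iff_valuation_eq_one] at hdet
  rw [← RingHom.map_det]
  exact hdet

theorem valuation_det_eq_one_of_sub_one {A : Matrix (Fin n) (Fin n) F}
    {c : ValueGroupWithZero F} (hc : c < 1) (hA : EntriesLE c (A - 1)) :
    valuation F A.det = 1 :=
  valuation_det_eq_one (c := 1) (map_one _) fun i j => by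
    simpa using (hA i j).trans_lt hc

theorem normAbs_congr {x y : Fˣ} (h : valuation F (x : F) = valuation F (y : F)) :
    normAbs x = normAbs y := by
  rw [normAbs, normAbs, h]

end Valuations

/-! ### Congruence subgroups: a basis of compact open neighbourhoods of 1. -/

section CongruenceSubgroups

variable {F : Type*} [Field F] [ValuativeRel F] [TopologicalSpace F]
  [IsNonarchimedeanLocalField F] {n : ℕ} {ϖ : 𝒪[F]} (hϖ : Irreducible ϖ)
include hϖ

theorem mem_congruenceSet_iff (ℓ : ℕ) (g : GL (Fin n) F) :
    g ∈ congruenceSet F n ℓ ↔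
      EntriesLE (valuation F (ϖ : F) ^ ℓ) ((g : Matrix (Fin n) (Fin n) F) - 1) := by
  refine forall₂_congr fun i j => ⟨?_, fun h => ?_⟩
  · rintro ⟨a, ha, h⟩
    rw [Matrix.sub_apply, h]
    exact (mem_maximalIdeal_pow_iff hϖ ℓ a).1 ha
  · have h1 : valuation F (((g : Matrix (Fin n) (Fin n) F) - 1) i j) ≤ 1 :=
      h.trans (pow_le_one' (valuation_uniformizer_lt_one hϖ).le ℓ)
    exact ⟨⟨_, h1⟩, (mem_maximalIdeal_pow_iff hϖ ℓ _).2 h, rfl⟩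

theorem congruenceSet_antitone : Antitone (congruenceSet F n) := fun ℓ m h g hg => by
  rw [mem_congruenceSet_iff hϖ] at hg ⊢
  exact hg.mono (pow_le_pow_right_of_le_one' (valuation_uniformizer_lt_one hϖ).le h)

theorem entriesLE_one_of_mem_congruenceSet {ℓ : ℕ} {g : GL (Fin n) F}
    (hg : g ∈ congruenceSet F n ℓ) : EntriesLE 1 (g : Matrix (Fin n) (Fin n) F) := by
  rw [mem_congruenceSet_iff hϖ] at hg
  simpa using (hg.mono (pow_le_one' (valuation_uniformizer_lt_one hϖ).le ℓ)).add EntriesLE.one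

theorem valuation_det_of_mem_congruenceSet {ℓ : ℕ} (hℓ : 1 ≤ ℓ) {g : GL (Fin n) F}
    (hg : g ∈ congruenceSet F n ℓ) :
    valuation F (Matrix.GeneralLinearGroup.det g : F) = 1 :=
  valuation_det_eq_one_of_sub_one
    (pow_lt_one' (valuation_uniformizer_lt_one hϖ) (by omega))
    ((mem_congruenceSet_iff hϖ ℓ g).1 hg)

theorem entriesLE_one_inv_of_mem_congruenceSet {ℓ : ℕ} (hℓ : 1 ≤ ℓ) {g : GL (Fin n) F}
    (hg : g ∈ congruenceSet F n ℓ) :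
    EntriesLE 1 ((g⁻¹ : GL (Fin n) F) : Matrix (Fin n) (Fin n) F) := by
  have hdet := valuation_det_of_mem_congruenceSet hϖ hℓ hg
  have hadj := (entriesLE_one_of_mem_congruenceSet hϖ hg).adjugate
  rw [Matrix.coe_units_inv, Matrix.inv_def, Ring.inverse_eq_inv']
  simpa using EntriesLE.smul (c := 1) (s := (g : Matrix (Fin n) (Fin n) F).det⁻¹)
    (by rw [map_inv₀]; exact (inv_eq_one.2 hdet).le) hadj

/-- The principal congruence subgroup of level `ℓ ≥ 1`. -/
def congruenceSubgroup {ℓ : ℕ} (hℓ : 1 ≤ ℓ) : Subgroup (GL (Fin n) F) where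
  carrier := congruenceSet F n ℓ
  one_mem' := by
    rw [mem_congruenceSet_iff hϖ]
    intro i j
    simp
  mul_mem' {a b} ha hb := by
    have ha1 := entriesLE_one_of_mem_congruenceSet hϖ ha
    rw [mem_congruenceSet_iff hϖ] at ha hb ⊢
    have h : ((a * b : GL (Fin n) F) : Matrix (Fin n) (Fin n) F) - 1 =
        (a : Matrix (Fin n) (Fin n) F) * (b - 1) + (a - 1) := by
      rw [Units.val_mul, mul_sub, mul_one]; abel
    rw [h]
    simpa using (ha1.mul hb).add (by simpa using ha)
  inv_mem' {a} ha := by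
    have ha1 := entriesLE_one_inv_of_mem_congruenceSet hϖ hℓ ha
    rw [mem_congruenceSet_iff hϖ] at ha ⊢
    have h : ((a⁻¹ : GL (Fin n) F) : Matrix (Fin n) (Fin n) F) - 1 =
        -(((a⁻¹ : GL (Fin n) F) : Matrix (Fin n) (Fin n) F) * (a - 1)) := by
      rw [mul_sub, mul_one, Units.inv_mul, neg_sub]
    rw [h]
    simpa using (ha1.mul ha).neg

theorem isOpen_congruenceSet (ℓ : ℕ) : IsOpen (congruenceSet F n ℓ) := by
  have h : congruenceSet F n ℓ = ⋂ i, ⋂ j, (fun g : GL (Fin n) F =>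
      (g : Matrix (Fin n) (Fin n) F) i j) ⁻¹' {x | valuation F
        (x - (1 : Matrix (Fin n) (Fin n) F) i j) ≤ valuation F (ϖ : F) ^ ℓ} := by
    ext g
    simp only [mem_congruenceSet_iff hϖ, EntriesLE, Set.mem_iInter]
    exact Iff.rfl
  rw [h]
  refine isOpen_iInter_of_finite fun i => isOpen_iInter_of_finite fun j =>
    (isOpen_valuation_sub_le _ (pow_ne_zero _ (valuation_uniformizer_ne_zero hϖ))).preimage ?_
  exact Units.continuous_val.matrix_elem i j

omit hϖ in
theorem isCompact_setOf_entriesLE (A : Matrix (Fin n) (Fin n) F) (c : ValueGroupWithZero F) :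
    IsCompact {B : Matrix (Fin n) (Fin n) F | EntriesLE c (B - A)} := by
  have h : IsCompact (Set.univ.pi fun i : Fin n => Set.univ.pi fun j : Fin n =>
      {x : F | valuation F (x - A i j) ≤ c}) := by
    refine isCompact_univ_pi fun i => isCompact_univ_pi fun j => ?_
    have h1 := (IsNonarchimedeanLocalField.isCompact_closedBall F c).image
      (continuous_id.add (continuous_const (y := A i j)))
    convert h1 using 1
    ext x
    simp only [Set.mem_ofPred_eq, Set.mem_image]
    exact ⟨fun hx => ⟨x - A i j, hx, by simp⟩, by rintro ⟨y, hy, rfl⟩; simpa using hy⟩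
  have h1 : {B : Matrix (Fin n) (Fin n) F | EntriesLE c (B - A)} = Set.univ.pi fun i : Fin n =>
      Set.univ.pi fun j : Fin n => {x : F | valuation F (x - A i j) ≤ c} := by
    ext B
    exact ⟨fun hB i _ j _ => hB i j, fun hB i j => hB i trivial j trivial⟩
  rw [h1]
  exact h

/-- The units embed as a closed subset by `g ↦ (g, g⁻¹)`; since inverses of elements of `K_ℓ` are
integral, `K_ℓ` is the preimage of a product of two compact sets. -/
theorem isCompact_congruenceSet {ℓ : ℕ} (hℓ : 1 ≤ ℓ) : IsCompact (congruenceSet F n ℓ) := by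
  have := t2Space_of_isNonarchimedeanLocalField F
  have hcl := Units.isClosedEmbedding_embedProduct (α := Matrix (Fin n) (Fin n) F)
  have hc := hcl.isCompact_preimage ((isCompact_setOf_entriesLE (1 : Matrix (Fin n) (Fin n) F)
    (valuation F (ϖ : F) ^ ℓ)).prod ((isCompact_setOf_entriesLE (0 : Matrix (Fin n) (Fin n) F)
    1).image MulOpposite.continuous_op))
  convert hc using 1
  ext g
  simp only [Set.mem_preimage, Set.mem_prod, Units.embedProduct_apply, Set.mem_ofPred_eq,
    Set.mem_image, MulOpposite.op_inj, exists_eq_right, sub_zero, mem_congruenceSet_iff hϖ]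
  exact ⟨fun h => ⟨h, entriesLE_one_inv_of_mem_congruenceSet hϖ hℓ
    ((mem_congruenceSet_iff hϖ _ _).2 h)⟩, fun h => h.1⟩

/-- The `K_m` form a decreasing family of compact sets with intersection `{1}`, so one of them
enters any neighbourhood of 1. -/
theorem exists_congruenceSet_subset {U : Set (GL (Fin n) F)} (hU : U ∈ 𝓝 1) :
    ∃ m, 1 ≤ m ∧ congruenceSet F n m ⊆ U := by
  have := t2Space_of_isNonarchimedeanLocalField F
  have key : ∀ x ∈ ⋂ m, congruenceSet F n (m + 1), U ∈ 𝓝 x := by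
    intro x hx
    suffices h : x = 1 by rwa [h]
    ext i j
    by_contra hij
    rw [← sub_eq_zero, ← ne_eq, ← (valuation F).ne_zero_iff, ← zero_lt_iff] at hij
    have hlt := valuation_uniformizer_lt_one hϖ
    obtain ⟨k, hk⟩ := MulArchimedean.arch
      ((valuation F (x i j - (1 : GL (Fin n) F) i j))⁻¹)
      (one_lt_inv₀ (zero_lt_iff.2 (valuation_uniformizer_ne_zero hϖ)) |>.2 hlt)
    have h1 := (mem_congruenceSet_iff hϖ _ _).1 (Set.mem_iInter.1 hx k) i j
    rw [inv_pow, inv_le_inv₀ hij (pow_pos (zero_lt_iff.2 (valuation_uniformizer_ne_zero hϖ)) k)]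
      at hk
    refine (h1.trans_lt ?_).not_ge hk
    exact pow_lt_pow_right_of_lt_one₀ (zero_lt_iff.2 (valuation_uniformizer_ne_zero hϖ)) hlt
      (Nat.lt_succ_self k)
  obtain ⟨m, hm⟩ := exists_subset_nhds_of_isCompact (V := fun m => congruenceSet F n (m + 1))
    (fun i j => ⟨max i j, congruenceSet_antitone hϖ (by simp),
      congruenceSet_antitone hϖ (by simp)⟩)
    (fun m => isCompact_congruenceSet hϖ (by omega)) key
  exact ⟨m + 1, by omega, hm⟩

end CongruenceSubgroups

/-! ### Invariance of matrix coefficients. -/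

section Coefficients

variable {F : Type*} [Field F] [ValuativeRel F] [TopologicalSpace F]
  [IsNonarchimedeanLocalField F] {n : ℕ}

/-- Matrix coefficients of the contragredient of a smooth representation are left invariant
under a principal congruence subgroup. -/
theorem exists_left_invariant_of_mem_contragredientCoeffs {ϖ : 𝒪[F]} (hϖ : Irreducible ϖ)
    {V : Type*} [AddCommGroup V] [Module ℂ V] {ρ : Representation ℂ (GL (Fin n) F) V}
    (hsmooth : IsSmoothRep ρ) {φ : GL (Fin n) F → ℂ} (hφ : φ ∈ contragredientCoeffs ρ) :
    ∃ m, 1 ≤ m ∧ ∀ k ∈ congruenceSet F n m, ∀ g, φ (k * g) = φ g := by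
  induction hφ using Submodule.span_induction with
  | mem f hf =>
    obtain ⟨v, w, rfl⟩ := hf
    obtain ⟨U, hU⟩ := hsmooth v
    obtain ⟨m, hm, hmU⟩ := exists_congruenceSet_subset hϖ (U.isOpen.mem_nhds U.one_mem)
    refine ⟨m, hm, fun k hk g => ?_⟩
    -- The coefficient is `g ↦ w(ρ(g⁻¹) v)`, so left translation by `k` acts through `ρ(k⁻¹)` on
    -- `v`.
    have h : ρ k⁻¹ v = v := hU _ (U.inv_mem (hmU hk))
    change ((w : Module.Dual ℂ V) ∘ₗ ρ (k * g)⁻¹) v = ((w : Module.Dual ℂ V) ∘ₗ ρ g⁻¹) v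
    rw [LinearMap.comp_apply, LinearMap.comp_apply, mul_inv_rev, map_mul, Module.End.mul_apply, h]
  | zero => exact ⟨1, le_rfl, fun _ _ _ => rfl⟩
  | add f₁ f₂ _ _ h₁ h₂ =>
    obtain ⟨m₁, hm₁, h₁⟩ := h₁
    obtain ⟨m₂, hm₂, h₂⟩ := h₂
    refine ⟨max m₁ m₂, hm₁.trans (le_max_left _ _), fun k hk g => ?_⟩
    rw [Pi.add_apply, Pi.add_apply, h₁ k (congruenceSet_antitone hϖ (le_max_left _ _) hk),
      h₂ k (congruenceSet_antitone hϖ (le_max_right _ _) hk)]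
  | smul a f _ h =>
    obtain ⟨m, hm, h⟩ := h
    exact ⟨m, hm, fun k hk g => by rw [Pi.smul_apply, Pi.smul_apply, h k hk]⟩

end Coefficients

/-! ### Two vanishing criteria for integrals on groups. -/

section Twist

variable {G : Type*} [Group G] [MeasurableSpace G] [MeasurableMul G] {μ : Measure G}
  [μ.IsMulLeftInvariant]

/-- The substitution `h ↦ k h` shows that the integral `I` satisfies `I = z I`. -/
theorem setIntegral_eq_zero_of_translate {S : Set G} (hS : MeasurableSet S) {f : G → ℂ} {z : ℂ}
    (hz : z ≠ 1) {k : G} (hk : ∀ h, k * h ∈ S ↔ h ∈ S) (hf : ∀ h ∈ S, f (k * h) = z * f h) :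
    ∫ h in S, f h ∂μ = 0 := by
  have h1 : ∫ h in S, f h ∂μ = z * ∫ h in S, f h ∂μ := by
    rw [← integral_indicator hS, ← integral_const_mul]
    nth_rw 1 [← integral_mul_left_eq_self _ k]
    refine integral_congr_ae (Eventually.of_forall fun h => ?_)
    by_cases hh : h ∈ S
    · simp only [Set.indicator_of_mem hh, Set.indicator_of_mem ((hk h).2 hh), hf h hh]
    · simp only [Set.indicator_of_notMem hh, Set.indicator_of_notMem (mt (hk h).1 hh), mul_zero]
  have h2 : (1 - z) * ∫ h in S, f h ∂μ = 0 := by rw [sub_mul, one_mul, ← h1, sub_self]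
  exact (mul_eq_zero.1 h2).resolve_left (sub_ne_zero.2 hz.symm)

end Twist

section Cosets

variable {G : Type*} [Group G] [TopologicalSpace G] [IsTopologicalGroup G] [MeasurableSpace G]
  [BorelSpace G] {μ : Measure G}

/-- If the integrals of a function supported in a compact set over all right cosets of an open
subgroup vanish, then its integral vanishes. -/
theorem integral_eq_zero_of_forall_coset {U : Subgroup G} (hU : IsOpen (U : Set G)) {f : G → ℂ}
    (hf : Integrable f μ) {K : Set G} (hK : IsCompact K) (hfK : ∀ g ∉ K, f g = 0)
    (h : ∀ g₀, ∫ g in {g | g * g₀⁻¹ ∈ U}, f g ∂μ = 0) : ∫ g, f g ∂μ = 0 := by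
  classical
  let q : G → Quotient (QuotientGroup.rightRel U) := Quotient.mk _
  have hq (a b : G) : q a = q b ↔ b * a⁻¹ ∈ U := by
    rw [← QuotientGroup.rightRel_apply]
    exact Quotient.eq
  have hopen (g₀ : G) : IsOpen {g | g * g₀⁻¹ ∈ U} := hU.preimage (continuous_mul_const g₀⁻¹)
  have hfib (g₀ : G) : {g | q g = q g₀} = {g | g * g₀⁻¹ ∈ U} := by
    ext g
    rw [Set.mem_ofPred_eq, eq_comm, hq]
    rfl
  have hcover := hK.elim_finite_subcover (fun g₀ : G => {g | g * g₀⁻¹ ∈ U}) hopen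
    (fun g _ => Set.mem_iUnion.2 ⟨g, by simp [U.one_mem]⟩)
  obtain ⟨t, ht⟩ := hcover
  -- Indexing by classes in the quotient, not by representatives, removes repetitions and makes the
  -- finite union disjoint.
  have hsub : Function.support f ⊆ ⋃ c ∈ t.image q, q ⁻¹' {c} := fun g hg => by
    have hgK : g ∈ K := by
      by_contra h'
      exact hg (hfK g h')
    obtain ⟨g₀, hg₀, hgg⟩ := Set.mem_iUnion₂.1 (ht hgK)
    refine Set.mem_iUnion₂.2 ⟨q g₀, Finset.mem_image_of_mem q hg₀, ?_⟩
    rw [← hfib] at hgg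
    exact hgg
  rw [← setIntegral_eq_integral_of_forall_compl_eq_zero
    (s := ⋃ c ∈ t.image q, q ⁻¹' {c}) fun g hg => by
      by_contra h'
      exact hg (hsub h')]
  rw [integral_biUnion_finset]
  · refine Finset.sum_eq_zero fun c hc => ?_
    obtain ⟨g₀, -, rfl⟩ := Finset.mem_image.1 hc
    have h1 : q ⁻¹' {q g₀} = {g | g * g₀⁻¹ ∈ U} := hfib g₀
    rw [h1, h]
  · intro c hc
    obtain ⟨g₀, -, rfl⟩ := Finset.mem_image.1 hc
    have h1 : q ⁻¹' {q g₀} = {g | g * g₀⁻¹ ∈ U} := hfib g₀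
    rw [h1]
    exact (hopen g₀).measurableSet
  · exact fun a _ b _ hab => Disjoint.preimage q (Set.disjoint_singleton.2 hab)
  · exact fun c _ => hf.integrableOn

end Cosets

/-! ### The Godement-Jacquet kernel and its convolution with `𝔠_ℓ^∨`. -/

section Kernel

variable {F : Type*} [Field F] [ValuativeRel F] [TopologicalSpace F]
  [IsNonarchimedeanLocalField F] {n : ℕ} {ϖ : 𝒪[F]} (hϖ : Irreducible ϖ)
  {ψ : AddChar F Circle} (hψ₀ : ∀ a : 𝒪[F], ψ (a : F) = 1)

/-- The determinant enters `Φ_GJ` only through its absolute value, so the trace alone decides how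
`Φ_GJ` changes. -/
theorem phiGJ_eq_mul {g h : GL (Fin n) F}
    (hdet : valuation F (Matrix.GeneralLinearGroup.det g : F) =
      valuation F (Matrix.GeneralLinearGroup.det h : F)) :
    phiGJ ψ g = (ψ (Matrix.trace
      ((g : Matrix (Fin n) (Fin n) F) - (h : Matrix (Fin n) (Fin n) F))) : ℂ) *
      phiGJ ψ h := by
  rw [phiGJ, phiGJ, normAbs_congr hdet, ← mul_assoc, ← Circle.coe_mul, ← AddChar.map_add_eq_mul,
    Matrix.trace_sub, sub_add_cancel]

include hψ₀ in
theorem phiGJ_congr {g h : GL (Fin n) F}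
    (hdet : valuation F (Matrix.GeneralLinearGroup.det g : F) =
      valuation F (Matrix.GeneralLinearGroup.det h : F))
    (hgh : valuation F (Matrix.trace
      ((g : Matrix (Fin n) (Fin n) F) - (h : Matrix (Fin n) (Fin n) F))) ≤ 1) :
    phiGJ ψ g = phiGJ ψ h := by
  rw [phiGJ_eq_mul hdet, hψ₀ ⟨_, hgh⟩, Circle.coe_one, one_mul]

omit [TopologicalSpace F] [IsNonarchimedeanLocalField F] in
-- Since `ψ` is nontrivial on `ϖ⁻¹𝔬`, take `s = ϖ⁻¹ a L⁻¹`. For large `L` this `s` is small enough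
-- to perturb inside a congruence subgroup.
theorem exists_addChar_mul_ne_one (hψ₁ : ∃ a : 𝒪[F], ψ ((ϖ : F)⁻¹ * (a : F)) ≠ 1)
    {L : F} (hL : L ≠ 0) :
    ∃ s : F, valuation F s ≤ (valuation F (ϖ : F) * valuation F L)⁻¹ ∧ (ψ (s * L) : ℂ) ≠ 1 := by
  obtain ⟨a, ha⟩ := hψ₁
  refine ⟨(ϖ : F)⁻¹ * a * L⁻¹, ?_, ?_⟩
  · rw [map_mul, map_mul, map_inv₀, map_inv₀, mul_inv]
    exact mul_le_mul' (mul_le_of_le_one_right' a.2) le_rfl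
  · rw [inv_mul_cancel_right₀ hL]
    exact fun h => ha (Circle.ext h)

include hϖ

theorem valuation_det_mul_of_mem_congruenceSet {ℓ : ℕ} (hℓ : 1 ≤ ℓ) {k : GL (Fin n) F}
    (hk : k ∈ congruenceSet F n ℓ) (g : GL (Fin n) F) :
    valuation F (Matrix.GeneralLinearGroup.det (k * g) : F) =
      valuation F (Matrix.GeneralLinearGroup.det g : F) := by
  rw [map_mul, Units.val_mul, map_mul, valuation_det_of_mem_congruenceSet hϖ hℓ hk, one_mul]

theorem exists_pow_mul_le_one (c : ValueGroupWithZero F) :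
    ∃ m, valuation F (ϖ : F) ^ m * c ≤ 1 := by
  have hpos := zero_lt_iff.2 (valuation_uniformizer_ne_zero hϖ)
  obtain ⟨k, hk⟩ := MulArchimedean.arch c
    (one_lt_inv₀ hpos |>.2 (valuation_uniformizer_lt_one hϖ))
  refine ⟨k, ?_⟩
  rw [inv_pow] at hk
  calc _ ≤ valuation F (ϖ : F) ^ k * (valuation F (ϖ : F) ^ k)⁻¹ := mul_le_mul' le_rfl hk
    _ = 1 := mul_inv_cancel₀ (pow_pos hpos k).ne'

/-- Around each `g` the function is constant on the open set `K_m g`; the level `m` may vary with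
`g`. -/
theorem continuous_of_left_invariant {Y : Type*} [TopologicalSpace Y] {f : GL (Fin n) F → Y}
    (hf : ∀ g, ∃ m, ∀ k ∈ congruenceSet F n m, f (k * g) = f g) : Continuous f := by
  refine IsLocallyConstant.continuous ((IsLocallyConstant.iff_eventually_eq f).2 fun g => ?_)
  obtain ⟨m, hm⟩ := hf g
  have h1 : IsOpen {h : GL (Fin n) F | h * g⁻¹ ∈ congruenceSet F n m} :=
    (isOpen_congruenceSet hϖ m).preimage (continuous_mul_const g⁻¹)
  have hg : g * g⁻¹ ∈ congruenceSet F n m := by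
    rw [mem_congruenceSet_iff hϖ, mul_inv_cancel]
    intro i j
    simp
  filter_upwards [h1.mem_nhds hg] with h hh
  simpa using hm _ hh

include hψ₀ in
theorem phiGJ_mul_left {ℓ : ℕ} (hℓ : 1 ≤ ℓ) {k g : GL (Fin n) F} (hk : k ∈ congruenceSet F n ℓ)
    {c : ValueGroupWithZero F} (hg : EntriesLE c (g : Matrix (Fin n) (Fin n) F))
    (hc : valuation F (ϖ : F) ^ ℓ * c ≤ 1) : phiGJ ψ (k * g) = phiGJ ψ g := by
  refine phiGJ_congr hψ₀ (valuation_det_mul_of_mem_congruenceSet hϖ hℓ hk g) ?_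
  have h1 := (((mem_congruenceSet_iff hϖ ℓ k).1 hk).mul hg).trace
  rw [sub_mul, one_mul] at h1
  exact h1.trans hc

include hψ₀ in
theorem phiGJ_mul_right {ℓ : ℕ} (hℓ : 1 ≤ ℓ) {k g : GL (Fin n) F} (hk : k ∈ congruenceSet F n ℓ)
    {c : ValueGroupWithZero F} (hg : EntriesLE c (g : Matrix (Fin n) (Fin n) F))
    (hc : valuation F (ϖ : F) ^ ℓ * c ≤ 1) : phiGJ ψ (g * k) = phiGJ ψ g := by
  have hdet : valuation F (Matrix.GeneralLinearGroup.det (g * k) : F) =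
      valuation F (Matrix.GeneralLinearGroup.det g : F) := by
    rw [map_mul, mul_comm, Units.val_mul, map_mul, valuation_det_of_mem_congruenceSet hϖ hℓ hk,
      one_mul]
  refine phiGJ_congr hψ₀ hdet ?_
  have h1 := (hg.mul ((mem_congruenceSet_iff hϖ ℓ k).1 hk)).trace
  rw [mul_sub, mul_one, mul_comm] at h1
  exact h1.trans hc

include hψ₀ in
theorem continuous_phiGJ : Continuous (phiGJ ψ : GL (Fin n) F → ℂ) := by
  refine continuous_of_left_invariant hϖ fun g => ?_
  obtain ⟨c, hg⟩ := exists_entriesLE (g : Matrix (Fin n) (Fin n) F)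
  obtain ⟨m, hm⟩ := exists_pow_mul_le_one hϖ c
  refine ⟨m + 1, fun k hk => phiGJ_mul_left hϖ hψ₀ (by omega) hk hg (le_trans ?_ hm)⟩
  exact mul_le_mul' (pow_le_pow_right_of_le_one' (valuation_uniformizer_lt_one hϖ).le
    (Nat.le_succ m)) le_rfl

/-- The element `1 + X` of a congruence subgroup. -/
theorem exists_mem_congruenceSet {ℓ : ℕ} (hℓ : 1 ≤ ℓ) {X : Matrix (Fin n) (Fin n) F}
    (hX : EntriesLE (valuation F (ϖ : F) ^ ℓ) X) :
    ∃ k ∈ congruenceSet F n ℓ, (k : Matrix (Fin n) (Fin n) F) = 1 + X := by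
  have h1 : EntriesLE (valuation F (ϖ : F) ^ ℓ) (1 + X - 1) := by simpa using hX
  have h2 := valuation_det_eq_one_of_sub_one
    (pow_lt_one' (valuation_uniformizer_lt_one hϖ) (by omega)) h1
  have h3 : (1 + X).det ≠ 0 := by
    rw [← (valuation F).ne_zero_iff, h2]
    exact one_ne_zero
  exact ⟨Matrix.GeneralLinearGroup.mkOfDetNeZero (1 + X) h3,
    (mem_congruenceSet_iff hϖ ℓ _).2 h1, rfl⟩

variable [MeasurableSpace (GL (Fin n) F)] [BorelSpace (GL (Fin n) F)]
  (μG : Measure (GL (Fin n) F)) [μG.IsHaarMeasure]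

include hψ₀ in
-- The integrand is a continuous function cut off to the compact open coset `g K_ℓ`.
theorem integrable_conv_integrand {ℓ : ℕ} (hℓ : 1 ≤ ℓ) (g : GL (Fin n) F) :
    Integrable (fun h : GL (Fin n) F =>
      phiGJ ψ h * check (approxDelta μG ℓ) (h⁻¹ * g)) μG := by
  have := t2Space_of_isNonarchimedeanLocalField F
  let S : Set (GL (Fin n) F) := {h | g⁻¹ * h ∈ congruenceSet F n ℓ}
  have hSo : IsOpen S := (isOpen_congruenceSet hϖ ℓ).preimage (continuous_const_mul g⁻¹)
  have hSc : IsCompact S := by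
    have := (isCompact_congruenceSet (n := n) hϖ hℓ).image (continuous_const_mul g)
    convert this using 1
    ext h
    exact ⟨fun hh => ⟨g⁻¹ * h, hh, by simp⟩, by rintro ⟨k, hk, rfl⟩; simpa [S] using hk⟩
  have heq : (fun h : GL (Fin n) F => phiGJ ψ h * check (approxDelta μG ℓ) (h⁻¹ * g)) =
      S.indicator fun h => phiGJ ψ h * ((μG.real (congruenceSet F n ℓ))⁻¹ : ℂ) := by
    funext h
    by_cases hh : g⁻¹ * h ∈ congruenceSet F n ℓ
    · rw [Set.indicator_of_mem (show h ∈ S from hh)]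
      simp [check, approxDelta, hh]
    · rw [Set.indicator_of_notMem (show h ∉ S from hh)]
      simp [check, approxDelta, hh]
  rw [heq, integrable_indicator_iff hSo.measurableSet]
  exact ((continuous_phiGJ hϖ hψ₀).mul continuous_const).continuousOn.integrableOn_compact hSc

include hψ₀ in
/-- Convolution with `𝔠_ℓ^∨` truncates `Φ_GJ` to matrices with entries in `𝔭^{-ℓ}`. -/
theorem conv_phiGJ (hψ₁ : ∃ a : 𝒪[F], ψ ((ϖ : F)⁻¹ * (a : F)) ≠ 1) {ℓ : ℕ} (hℓ : 1 ≤ ℓ)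
    (g : GL (Fin n) F) [Decidable (EntriesLE (valuation F (ϖ : F) ^ ℓ)⁻¹
      (g : Matrix (Fin n) (Fin n) F))] :
    conv μG (phiGJ ψ) (check (approxDelta μG ℓ)) g =
      if EntriesLE (valuation F (ϖ : F) ^ ℓ)⁻¹ (g : Matrix (Fin n) (Fin n) F)
      then phiGJ ψ g else 0 := by
  have hpos : 0 < valuation F (ϖ : F) := zero_lt_iff.2 (valuation_uniformizer_ne_zero hϖ)
  have hpow : 0 < valuation F (ϖ : F) ^ ℓ := pow_pos hpos ℓ
  set K := congruenceSet F n ℓ with hK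
  have hKm : MeasurableSet K := (isOpen_congruenceSet hϖ ℓ).measurableSet
  have hvol : μG.real K ≠ 0 := by
    have h1 : 1 ∈ K := (congruenceSubgroup (n := n) hϖ hℓ).one_mem
    have h2 := (isOpen_congruenceSet hϖ ℓ).measure_pos μG ⟨1, h1⟩
    exact (ENNReal.toReal_pos h2.ne' (isCompact_congruenceSet hϖ hℓ).measure_lt_top.ne).ne'
  have h1 : conv μG (phiGJ ψ) (check (approxDelta μG ℓ)) g =
      (∫ k in K, phiGJ ψ (g * k) ∂μG) * ((μG.real K)⁻¹ : ℂ) := by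
    rw [conv, ← integral_mul_left_eq_self _ g, ← integral_mul_const, ← integral_indicator hKm]
    refine integral_congr_ae (Eventually.of_forall fun k => ?_)
    by_cases hk : k ∈ K
    · simp [check, approxDelta, ← hK, hk]
    · simp [check, approxDelta, ← hK, hk]
  rw [h1]
  split_ifs with hg
  · have h2 : ∫ k in K, phiGJ ψ (g * k) ∂μG = ∫ k in K, phiGJ ψ g ∂μG :=
      setIntegral_congr_fun hKm fun k hk =>
        phiGJ_mul_right hϖ hψ₀ hℓ hk hg (mul_inv_cancel₀ hpow.ne').le
    rw [h2, setIntegral_const, Complex.real_smul, mul_comm, ← mul_assoc, inv_mul_cancel₀, one_mul]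
    exact_mod_cast hvol
  · obtain ⟨i₀, j₀, h0⟩ : ∃ i j, (valuation F (ϖ : F) ^ ℓ)⁻¹ <
        valuation F ((g : Matrix (Fin n) (Fin n) F) i j) := by
      simpa only [EntriesLE, not_forall, not_le] using hg
    -- With the largest entry `y` in position `(j, i)`, the perturbation `1 + s E_ij` adds `s y` to
    -- the trace, up to an error bounded in terms of `|y|`.
    obtain ⟨⟨j, i⟩, -, hmax⟩ := Finset.exists_max_image Finset.univ
      (fun p : Fin n × Fin n => valuation F ((g : Matrix (Fin n) (Fin n) F) p.1 p.2))
      ⟨(i₀, j₀), Finset.mem_univ _⟩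
    set y := (g : Matrix (Fin n) (Fin n) F) j i
    have hy : (valuation F (ϖ : F) ^ ℓ)⁻¹ < valuation F y :=
      h0.trans_le (hmax (i₀, j₀) (Finset.mem_univ _))
    have hy0 : 0 < valuation F y := zero_le.trans_lt hy
    have hgy : EntriesLE (valuation F y) (g : Matrix (Fin n) (Fin n) F) :=
      fun a b => hmax (a, b) (Finset.mem_univ _)
    obtain ⟨s, hs, hsψ⟩ := exists_addChar_mul_ne_one hψ₁ ((valuation F).ne_zero_iff.1 hy0.ne')
    have hsℓ : valuation F s ≤ valuation F (ϖ : F) ^ ℓ := by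
      refine hs.trans (inv_le_of_inv_le₀ hpow ?_)
      -- By discreteness `|y| > |ϖ|^{-ℓ}` improves to `|ϖ y| ≥ |ϖ|^{-ℓ}`, which absorbs the factor
      -- `ϖ⁻¹` in `s`.
      exact le_mul_valuation_of_lt hϖ hy
    have hX : EntriesLE (valuation F s) (Matrix.single i j s) := fun a b => by
      rw [Matrix.single_apply]
      split_ifs <;> simp
    obtain ⟨k₀, hk₀, hk₀X⟩ := exists_mem_congruenceSet hϖ hℓ (hX.mono hsℓ)
    rw [setIntegral_eq_zero_of_translate hKm hsψ
      (fun h => (congruenceSubgroup hϖ hℓ).mul_mem_cancel_left hk₀), zero_mul]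
    intro k hk
    have hdet : valuation F (Matrix.GeneralLinearGroup.det (g * (k₀ * k)) : F) =
        valuation F (Matrix.GeneralLinearGroup.det (g * k) : F) := by
      simp only [map_mul, Units.val_mul, valuation_det_of_mem_congruenceSet hϖ hℓ hk₀, one_mul]
    rw [phiGJ_eq_mul hdet]
    congr 2
    have htr : Matrix.trace (((g * (k₀ * k) : GL (Fin n) F) : Matrix (Fin n) (Fin n) F) -
        ((g * k : GL (Fin n) F) : Matrix (Fin n) (Fin n) F)) = s * y +
        s * ((k - 1 : Matrix (Fin n) (Fin n) F) * g) j i := by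
      simp only [Units.val_mul, hk₀X]
      rw [← mul_sub, add_mul, one_mul, add_sub_cancel_left, Matrix.trace_mul_comm, mul_assoc,
        Matrix.trace_mul_comm, Matrix.trace_mul_single, sub_mul, one_mul, Matrix.sub_apply]
      simp only [y, MulOpposite.smul_eq_mul_unop, MulOpposite.unop_op]
      ring
    rw [htr, AddChar.map_add_eq_mul]
    -- Here `ℓ ≥ 1` matters: one factor `ϖ` from `k - 1` cancels the `ϖ⁻¹` in `s`.
    have hint : valuation F (s * ((k - 1 : Matrix (Fin n) (Fin n) F) * g) j i) ≤ 1 := by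
      have h3 := (((mem_congruenceSet_iff hϖ ℓ k).1 hk).mul hgy) j i
      rw [map_mul]
      calc _ ≤ (valuation F (ϖ : F) * valuation F y)⁻¹ *
            (valuation F (ϖ : F) ^ 1 * valuation F y) := mul_le_mul' hs (h3.trans
              (mul_le_mul' (pow_le_pow_right_of_le_one' (valuation_uniformizer_lt_one hϖ).le hℓ)
                le_rfl))
        _ = 1 := by
          rw [pow_one]
          exact inv_mul_cancel₀ (mul_pos hpos hy0).ne'
    rw [hψ₀ ⟨_, hint⟩, mul_one]

end Kernel

/-! ### Detecting near-scalar matrices by directions tangent to `SL_n`. -/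

section NearScalar

variable {F : Type*} [Field F] [ValuativeRel F] [TopologicalSpace F]
  [IsNonarchimedeanLocalField F] {n : ℕ}

/-- Supplies lines `1 + sX` lying exactly in `SL_n`: `X = u wᵀ` is square-zero when `w ⬝ᵥ u = 0`. -/
theorem det_one_add_smul_vecMulVec {R : Type*} [CommRing R] (s : R) {u w : Fin n → R}
    (h : w ⬝ᵥ u = 0) : (1 + s • Matrix.vecMulVec u w).det = 1 := by
  rw [← Matrix.smul_vecMulVec, Matrix.vecMulVec_eq Unit,
    Matrix.det_one_add_replicateCol_mul_replicateRow, dotProduct_smul, h, smul_zero, add_zero]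

/-- A matrix whose largest entry has valuation `|ϖ|^{-N}` but whose determinant is smaller than
`|ϖ|^{-nN}` is far from scalar, as is detected by an integral direction `X` tangent to `SL_n`. -/
theorem exists_trace_mul_gt {ϖ : 𝒪[F]} (hϖ : Irreducible ϖ) {r N : ℕ} (hrN : r < N)
    {A : Matrix (Fin n) (Fin n) F} {a b : Fin n}
    (hab : valuation F (A a b) = (valuation F (ϖ : F) ^ N)⁻¹)
    (hdet : valuation F A.det * (valuation F (ϖ : F) ^ N) ^ n ≠ 1) :
    ∃ X : Matrix (Fin n) (Fin n) F, EntriesLE 1 X ∧ (∀ s : F, (1 + s • X).det = 1) ∧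
      (valuation F (ϖ : F) ^ r)⁻¹ < valuation F (X * A).trace := by
  by_contra! H
  have hlt := valuation_uniformizer_lt_one hϖ
  have hpos : 0 < valuation F (ϖ : F) := zero_lt_iff.2 (valuation_uniformizer_ne_zero hϖ)
  have hle (u w : Fin n → F) (hu : ∀ i, valuation F (u i) ≤ 1) (hw : ∀ i, valuation F (w i) ≤ 1)
      (h : w ⬝ᵥ u = 0) : valuation F (Matrix.vecMulVec u w * A).trace ≤
        (valuation F (ϖ : F) ^ r)⁻¹ := by
    refine H _ (fun i j => ?_) fun s => det_one_add_smul_vecMulVec s h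
    rw [Matrix.vecMulVec_apply, map_mul]
    exact mul_le_one' (hu i) (hw j)
  have hsingle (i j : Fin n) : valuation F ((Pi.single i 1 : Fin n → F) j) ≤ 1 := by
    rw [Pi.single_apply]
    split_ifs <;> simp
  have hoff (i j : Fin n) (hij : i ≠ j) : valuation F (A i j) ≤ (valuation F (ϖ : F) ^ r)⁻¹ := by
    have h := hle (Pi.single j 1) (Pi.single i 1) (hsingle j) (hsingle i) (by simp [hij.symm])
    simpa [Matrix.vecMulVec_mul, Matrix.trace_vecMulVec] using h
  -- The direction `(e_i + e_j)(e_i - e_j)ᵀ` yields `A_ii - A_jj` up to off-diagonal entries, with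
  -- no division by 2.
  have hdiag (i j : Fin n) : valuation F (A i i - A j j) ≤ (valuation F (ϖ : F) ^ r)⁻¹ := by
    by_cases hij : i = j
    · simp [hij]
    have h := hle (Pi.single i 1 + Pi.single j 1) (Pi.single i 1 - Pi.single j 1)
      (fun k => Valuation.map_add_le _ (hsingle i k) (hsingle j k))
      (fun k => Valuation.map_sub_le _ (hsingle i k) (hsingle j k))
      (by simp [hij, Ne.symm hij])
    have h1 : A i i - A j j = (Matrix.vecMulVec (Pi.single i 1 + Pi.single j 1 : Fin n → F)
        (Pi.single i 1 - Pi.single j 1) * A).trace + A j i - A i j := by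
      simp [Matrix.vecMulVec_mul, Matrix.trace_vecMulVec, Matrix.sub_vecMul, add_dotProduct]
      ring
    rw [h1]
    exact Valuation.map_sub_le _ (Valuation.map_add_le _ h (hoff j i (Ne.symm hij))) (hoff i j hij)
  have hlt' : valuation F (ϖ : F) ^ N * (valuation F (ϖ : F) ^ r)⁻¹ < 1 := by
    rw [← div_eq_mul_inv, div_lt_one₀ (pow_pos hpos r)]
    exact pow_lt_pow_right_of_lt_one₀ hpos hlt hrN
  have hval : valuation F (((ϖ : F) ^ N) * A a b) = 1 := by
    rw [map_mul, map_pow, hab, mul_inv_cancel₀ (pow_pos hpos N).ne']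
  have haa : a = b := by
    by_contra hne
    have h1 : valuation F (((ϖ : F) ^ N) * A a b) < 1 := by
      rw [map_mul, map_pow]
      exact (mul_le_mul' le_rfl (hoff a b hne)).trans_lt hlt'
    exact h1.ne hval
  subst haa
  refine hdet ?_
  -- After scaling by `ϖ^N` the matrix is congruent to the unit scalar `ϖ^N A_aa` modulo the maximal
  -- ideal, because `r < N`.
  have h1 := valuation_det_eq_one (A := ((ϖ : F) ^ N) • A) hval fun i j => ?_
  · rwa [Matrix.det_smul, Fintype.card_fin, map_mul, map_pow, map_pow, mul_comm] at h1
  · have h2 : valuation F (A i j - (A a a • (1 : Matrix (Fin n) (Fin n) F)) i j) ≤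
        (valuation F (ϖ : F) ^ r)⁻¹ := by
      by_cases hij : i = j
      · subst hij
        simpa using hdiag i a
      · simpa [hij] using hoff i j hij
    rw [mul_smul, Matrix.smul_apply, Matrix.smul_apply, ← smul_sub, smul_eq_mul, map_mul, map_pow]
    exact (mul_le_mul' le_rfl h2).trans_lt hlt'

end NearScalar

/-! ### Integrals over the determinant fibers: convergence, stability, local constancy. -/

section Fibers

variable {F : Type*} [Field F] [ValuativeRel F] [TopologicalSpace F]
  [IsNonarchimedeanLocalField F] {n : ℕ} {ϖ : 𝒪[F]} (hϖ : Irreducible ϖ)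
  {ψ : AddChar F Circle} (hψ₀ : ∀ a : 𝒪[F], ψ (a : F) = 1)
  (hψ₁ : ∃ a : 𝒪[F], ψ ((ϖ : F)⁻¹ * (a : F)) ≠ 1)

/-- The invertible matrices whose entries have valuation at most `c`. -/
def boundedSet (F : Type*) [Field F] [ValuativeRel F] (n : ℕ) (c : ValueGroupWithZero F) :
    Set (GL (Fin n) F) :=
  {g | EntriesLE c (g : Matrix (Fin n) (Fin n) F)}

theorem continuous_toGL : Continuous fun h : Matrix.SpecialLinearGroup (Fin n) F =>
    (Matrix.SpecialLinearGroup.toGL h : GL (Fin n) F) := by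
  have h := continuous_subtype_val.comp
    (continuous_toFiber (⟨1, map_one _⟩ : DetFiber (F := F) n 1))
  refine h.congr fun k => ?_
  simp [toFiber]

/-- `SL_n` is closed in the matrix space, so a bound on entries suffices and inverses need no
separate control. -/
theorem isCompact_preimage_boundedSet (d : GL (Fin n) F) (c : ValueGroupWithZero F) :
    IsCompact {h : Matrix.SpecialLinearGroup (Fin n) F |
      d * Matrix.SpecialLinearGroup.toGL h ∈ boundedSet F n c} := by
  have := t2Space_of_isNonarchimedeanLocalField F
  have h1 := (isCompact_setOf_entriesLE (0 : Matrix (Fin n) (Fin n) F) c).image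
    (continuous_const_mul ((d⁻¹ : GL (Fin n) F) : Matrix (Fin n) (Fin n) F))
  have hcl : IsClosed {A : Matrix (Fin n) (Fin n) F | A.det = 1} :=
    isClosed_eq continuous_id.matrix_det continuous_const
  have h2 : Topology.IsClosedEmbedding
      (Subtype.val : Matrix.SpecialLinearGroup (Fin n) F → Matrix (Fin n) (Fin n) F) :=
    hcl.isClosedEmbedding_subtypeVal
  have heq : {h : Matrix.SpecialLinearGroup (Fin n) F |
      d * Matrix.SpecialLinearGroup.toGL h ∈ boundedSet F n c} = Subtype.val ⁻¹'
        ((((d⁻¹ : GL (Fin n) F) : Matrix (Fin n) (Fin n) F) * ·) '' {B | EntriesLE c (B - 0)}) := by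
    ext h
    simp only [sub_zero]
    refine ⟨fun hh => ⟨_, hh, ?_⟩, ?_⟩
    · exact congrArg Units.val (inv_mul_cancel_left d (Matrix.SpecialLinearGroup.toGL h))
    · rintro ⟨A, hA, hAh⟩
      have h3 : ((d * Matrix.SpecialLinearGroup.toGL h : GL (Fin n) F) :
          Matrix (Fin n) (Fin n) F) = A := by
        rw [Units.val_mul]
        change (d : Matrix (Fin n) (Fin n) F) * h.1 = A
        rw [← hAh, ← mul_assoc, ← Units.val_mul, mul_inv_cancel, Units.val_one, one_mul]
      change EntriesLE c _
      rwa [h3]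
  rw [heq]
  exact h2.isCompact_preimage h1

include hϖ

theorem mul_mem_boundedSet_iff {ℓ : ℕ} (hℓ : 1 ≤ ℓ) {k : GL (Fin n) F}
    (hk : k ∈ congruenceSet F n ℓ) (g : GL (Fin n) F) (c : ValueGroupWithZero F) :
    k * g ∈ boundedSet F n c ↔ g ∈ boundedSet F n c := by
  refine ⟨fun h => ?_, fun h => ?_⟩
  · have h1 := (entriesLE_one_inv_of_mem_congruenceSet hϖ hℓ hk).mul h
    rwa [one_mul, ← Units.val_mul, inv_mul_cancel_left] at h1
  · have h1 := (entriesLE_one_of_mem_congruenceSet hϖ hk).mul h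
    rwa [one_mul] at h1

variable [MeasurableSpace (GL (Fin n) F)] [BorelSpace (GL (Fin n) F)]
  (μG : Measure (GL (Fin n) F)) [μG.IsHaarMeasure]

include hψ₀ hψ₁

theorem fiberIntegrand_eq_indicator (φ : GL (Fin n) F → ℂ) {ℓ : ℕ} (hℓ : 1 ≤ ℓ)
    (g : GL (Fin n) F) : fiberIntegrand μG ψ φ ℓ g =
      (boundedSet F n (valuation F (ϖ : F) ^ ℓ)⁻¹).indicator (fun g => phiGJ ψ g * φ g) g := by
  classical
  rw [fiberIntegrand, conv_phiGJ hϖ hψ₀ μG hψ₁ hℓ, ite_mul, zero_mul]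
  rfl

/-- Level `m` serves `φ`; level `ℓ` serves `Φ_GJ`, since on the truncated support `(k - 1) g` is
integral. -/
theorem fiberIntegrand_mul_left {φ : GL (Fin n) F → ℂ} {m : ℕ}
    (hφ : ∀ k ∈ congruenceSet F n m, ∀ g, φ (k * g) = φ g) {ℓ : ℕ} (hℓ : 1 ≤ ℓ)
    {k : GL (Fin n) F} (hk : k ∈ congruenceSet F n (max ℓ m)) (g : GL (Fin n) F) :
    fiberIntegrand μG ψ φ ℓ (k * g) = fiberIntegrand μG ψ φ ℓ g := by
  have hkℓ := congruenceSet_antitone hϖ (le_max_left ℓ m) hk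
  have hkm := congruenceSet_antitone hϖ (le_max_right ℓ m) hk
  have hiff := mul_mem_boundedSet_iff hϖ hℓ hkℓ g (valuation F (ϖ : F) ^ ℓ)⁻¹
  rw [fiberIntegrand_eq_indicator hϖ hψ₀ hψ₁ μG φ hℓ,
    fiberIntegrand_eq_indicator hϖ hψ₀ hψ₁ μG φ hℓ]
  by_cases hg : g ∈ boundedSet F n (valuation F (ϖ : F) ^ ℓ)⁻¹
  · rw [Set.indicator_of_mem hg, Set.indicator_of_mem (hiff.2 hg), hφ k hkm,
      phiGJ_mul_left hϖ hψ₀ hℓ hkℓ hg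
        (mul_inv_cancel₀ (pow_ne_zero _ (valuation_uniformizer_ne_zero hϖ))).le]
  · rw [Set.indicator_of_notMem hg, Set.indicator_of_notMem (mt hiff.1 hg)]

theorem continuous_fiberIntegrand {φ : GL (Fin n) F → ℂ} {m : ℕ}
    (hφ : ∀ k ∈ congruenceSet F n m, ∀ g, φ (k * g) = φ g) {ℓ : ℕ} (hℓ : 1 ≤ ℓ) :
    Continuous (fiberIntegrand μG ψ φ ℓ) :=
  continuous_of_left_invariant hϖ fun g =>
    ⟨max ℓ m, fun _ hk => fiberIntegrand_mul_left hϖ hψ₀ hψ₁ μG hφ hℓ hk g⟩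

variable [MeasurableSpace (Matrix.SpecialLinearGroup (Fin n) F)]
  [BorelSpace (Matrix.SpecialLinearGroup (Fin n) F)]
  (μS : Measure (Matrix.SpecialLinearGroup (Fin n) F)) [μS.IsHaarMeasure]

theorem integrable_fiberIntegrand_mul {φ : GL (Fin n) F → ℂ} {m : ℕ}
    (hφ : ∀ k ∈ congruenceSet F n m, ∀ g, φ (k * g) = φ g) {ℓ : ℕ} (hℓ : 1 ≤ ℓ)
    (d : GL (Fin n) F) :
    Integrable (fun h : Matrix.SpecialLinearGroup (Fin n) F =>
      fiberIntegrand μG ψ φ ℓ (d * Matrix.SpecialLinearGroup.toGL h)) μS := by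
  have := t2Space_of_isNonarchimedeanLocalField F
  have : T2Space (Matrix.SpecialLinearGroup (Fin n) F) := inferInstanceAs (T2Space (Subtype _))
  refine Continuous.integrable_of_hasCompactSupport
    ((continuous_fiberIntegrand hϖ hψ₀ hψ₁ μG hφ hℓ).comp (continuous_const.mul continuous_toGL))
    (HasCompactSupport.intro
      (isCompact_preimage_boundedSet d (valuation F (ϖ : F) ^ ℓ)⁻¹) fun h hh => ?_)
  rw [fiberIntegrand_eq_indicator hϖ hψ₀ hψ₁ μG φ hℓ]
  exact Set.indicator_of_notMem (show _ ∉ boundedSet F n _ from hh) _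

variable [NeZero n]

omit [MeasurableSpace (Matrix.SpecialLinearGroup (Fin n) F)]
  [BorelSpace (Matrix.SpecialLinearGroup (Fin n) F)] [NeZero n] in
theorem aestronglyMeasurable_fiberIntegrand {φ : GL (Fin n) F → ℂ} {m : ℕ}
    (hφ : ∀ k ∈ congruenceSet F n m, ∀ g, φ (k * g) = φ g) {ℓ : ℕ} (hℓ : 1 ≤ ℓ) {x : Fˣ}
    (ν : Measure (DetFiber n x)) :
    AEStronglyMeasurable (fun g : DetFiber n x => fiberIntegrand μG ψ φ ℓ g.1) ν :=
  ((continuous_fiberIntegrand hϖ hψ₀ hψ₁ μG hφ hℓ).comp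
    continuous_subtype_val).measurable.stronglyMeasurable.aestronglyMeasurable

theorem integrable_fiberIntegrand {φ : GL (Fin n) F → ℂ} {m : ℕ}
    (hφ : ∀ k ∈ congruenceSet F n m, ∀ g, φ (k * g) = φ g) {ℓ : ℕ} (hℓ : 1 ≤ ℓ) (x : Fˣ) :
    Integrable (fun g : DetFiber n x => fiberIntegrand μG ψ φ ℓ g.1) (fiberMeasure μS x) := by
  rw [fiberMeasure, integrable_map_measure
    (aestronglyMeasurable_fiberIntegrand hϖ hψ₀ hψ₁ μG hφ hℓ _)
    (continuous_toFiber _).measurable.aemeasurable]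
  exact integrable_fiberIntegrand_mul hϖ hψ₀ hψ₁ μG μS hφ hℓ (diagElt n x)

omit [μS.IsHaarMeasure] in
theorem fiberIntegral_eq {φ : GL (Fin n) F → ℂ} {m : ℕ}
    (hφ : ∀ k ∈ congruenceSet F n m, ∀ g, φ (k * g) = φ g) {ℓ : ℕ} (hℓ : 1 ≤ ℓ) (x : Fˣ) :
    fiberIntegral μG μS ψ φ ℓ x = ∫ h : Matrix.SpecialLinearGroup (Fin n) F,
      fiberIntegrand μG ψ φ ℓ (diagElt n x * Matrix.SpecialLinearGroup.toGL h) ∂μS := by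
  rw [fiberIntegral, fiberMeasure, integral_map (continuous_toFiber _).measurable.aemeasurable
    (aestronglyMeasurable_fiberIntegrand hϖ hψ₀ hψ₁ μG hφ hℓ _)]
  rfl

/-- The integral of `Φ_GJ φ` over the matrices of the fiber with largest entry of valuation
exactly `|ϖ|^{-(ℓ+1)}` vanishes for large `ℓ`. -/
theorem fiberIntegral_succ {φ : GL (Fin n) F → ℂ} {m : ℕ} (hm : 1 ≤ m)
    (hφ : ∀ k ∈ congruenceSet F n m, ∀ g, φ (k * g) = φ g) {ℓ : ℕ} (hℓ : 2 * m ≤ ℓ) {x : Fˣ}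
    (hx : valuation F (x : F) * valuation F (ϖ : F) ^ (ℓ + 1) < 1) :
    fiberIntegral μG μS ψ φ (ℓ + 1) x = fiberIntegral μG μS ψ φ ℓ x := by
  have hlt := valuation_uniformizer_lt_one hϖ
  have hpos : 0 < valuation F (ϖ : F) := zero_lt_iff.2 (valuation_uniformizer_ne_zero hϖ)
  have hℓ1 : 1 ≤ ℓ := by omega
  -- Half of `ℓ + 1`, rounded up: deep enough that quadratic errors are integral, yet below `ℓ + 1`
  -- so that near-scalar matrices are controlled.
  obtain ⟨r, hrm, hr1, hrℓ, hr2⟩ : ∃ r, m ≤ r ∧ 1 ≤ r ∧ r < ℓ + 1 ∧ ℓ + 1 ≤ r + r :=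
    ⟨(ℓ + 2) / 2, by omega, by omega, by omega, by omega⟩
  have hint := integrable_fiberIntegrand_mul hϖ hψ₀ hψ₁ μG μS hφ hℓ1 (diagElt n x)
  have hint' := integrable_fiberIntegrand_mul hϖ hψ₀ hψ₁ μG μS hφ (Nat.le_add_left 1 ℓ)
    (diagElt n x)
  rw [fiberIntegral_eq hϖ hψ₀ hψ₁ μG μS hφ (Nat.le_add_left 1 ℓ),
    fiberIntegral_eq hϖ hψ₀ hψ₁ μG μS hφ hℓ1, ← sub_eq_zero, ← integral_sub hint' hint]
  set d : GL (Fin n) F := diagElt n x with hd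
  set B₁ := boundedSet F n (valuation F (ϖ : F) ^ (ℓ + 1))⁻¹ with hB₁
  set B₀ := boundedSet F n (valuation F (ϖ : F) ^ ℓ)⁻¹ with hB₀
  have hB : B₀ ⊆ B₁ := fun g hg => EntriesLE.mono hg
    (inv_anti₀ (pow_pos hpos _) (pow_le_pow_right_of_le_one' hlt.le (Nat.le_succ ℓ)))
  have hdiff (g : GL (Fin n) F) : fiberIntegrand μG ψ φ (ℓ + 1) g - fiberIntegrand μG ψ φ ℓ g =
      (B₁ \ B₀).indicator (fun g => phiGJ ψ g * φ g) g := by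
    rw [fiberIntegrand_eq_indicator hϖ hψ₀ hψ₁ μG φ (Nat.le_add_left 1 ℓ),
      fiberIntegrand_eq_indicator hϖ hψ₀ hψ₁ μG φ hℓ1, Set.indicator_sdiff hB]
    rfl
  have hstab {k : GL (Fin n) F} (hk : k ∈ congruenceSet F n r) (g : GL (Fin n) F) :
      k * g ∈ B₁ \ B₀ ↔ g ∈ B₁ \ B₀ := by
    rw [Set.mem_sdiff, Set.mem_sdiff, mul_mem_boundedSet_iff hϖ hr1 hk,
      mul_mem_boundedSet_iff hϖ hr1 hk]
  -- Conjugation by `d` turns left translation by `K_r ∩ SL_n` on the fiber into left translation by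
  -- `U` on `SL_n`.
  let U : Subgroup (Matrix.SpecialLinearGroup (Fin n) F) :=
    (congruenceSubgroup hϖ hr1).comap
      ((MulAut.conj d).toMonoidHom.comp Matrix.SpecialLinearGroup.toGL)
  have hU : IsOpen (U : Set (Matrix.SpecialLinearGroup (Fin n) F)) :=
    (isOpen_congruenceSet hϖ r).preimage
      ((continuous_const.mul continuous_toGL).mul continuous_const)
  refine integral_eq_zero_of_forall_coset hU (hint'.sub hint)
    (isCompact_preimage_boundedSet d (valuation F (ϖ : F) ^ (ℓ + 1))⁻¹) (fun h hh => ?_)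
    fun h₀ => ?_
  · rw [hdiff, Set.indicator_of_notMem fun h' => hh h'.1]
  have hcoset {h : Matrix.SpecialLinearGroup (Fin n) F} (hh : h * h₀⁻¹ ∈ U) :
      ∃ k ∈ congruenceSet F n r, d * Matrix.SpecialLinearGroup.toGL h =
        k * (d * Matrix.SpecialLinearGroup.toGL h₀) := by
    refine ⟨_, hh, ?_⟩
    simp [mul_assoc]
  simp only [hdiff]
  by_cases hT : d * Matrix.SpecialLinearGroup.toGL h₀ ∈ B₁ \ B₀
  swap
  · refine setIntegral_eq_zero_of_forall_eq_zero fun h hh => ?_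
    obtain ⟨k, hk, hkh⟩ := hcoset hh
    rw [hkh, Set.indicator_of_notMem (mt (hstab hk _).1 hT)]
  set g₀ : GL (Fin n) F := d * Matrix.SpecialLinearGroup.toGL h₀ with hg₀
  have hdetg₀ : (g₀ : Matrix (Fin n) (Fin n) F).det = x := by
    have h1 := (toFiber ⟨d, det_diagElt x⟩ h₀).2
    exact congrArg Units.val h1
  obtain ⟨a, b, hab⟩ : ∃ a b, (valuation F (ϖ : F) ^ ℓ)⁻¹ <
      valuation F ((g₀ : Matrix (Fin n) (Fin n) F) a b) := by
    have := hT.2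
    simpa only [hB₀, boundedSet, EntriesLE, Set.mem_ofPred_eq, not_forall, not_le] using this
  have hab' : valuation F ((g₀ : Matrix (Fin n) (Fin n) F) a b) =
      (valuation F (ϖ : F) ^ (ℓ + 1))⁻¹ := by
    refine le_antisymm (hT.1 a b) ?_
    have h1 := le_mul_valuation_of_lt hϖ hab
    rw [pow_succ', mul_inv]
    calc _ ≤ (valuation F (ϖ : F))⁻¹ * (valuation F (ϖ : F) *
          valuation F ((g₀ : Matrix (Fin n) (Fin n) F) a b)) := mul_le_mul' le_rfl h1
      _ = _ := inv_mul_cancel_left₀ hpos.ne' _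
  have hdetne : valuation F (g₀ : Matrix (Fin n) (Fin n) F).det *
      (valuation F (ϖ : F) ^ (ℓ + 1)) ^ n ≠ 1 := by
    rw [hdetg₀]
    -- As `n ≥ 1`, the bound with exponent `ℓ + 1` implies the one with exponent `(ℓ + 1) n`.
    refine (lt_of_le_of_lt (mul_le_mul' le_rfl ?_) hx).ne
    exact pow_le_of_le_one zero_le (pow_le_one' hlt.le _) (NeZero.ne n)
  obtain ⟨X, hX, hXdet, hXg⟩ := exists_trace_mul_gt hϖ hrℓ hab' hdetne
  set L := (X * (g₀ : Matrix (Fin n) (Fin n) F)).trace with hL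
  have hL0 : L ≠ 0 := (valuation F).ne_zero_iff.1 (zero_le.trans_lt hXg).ne'
  obtain ⟨s, hs, hsψ⟩ := exists_addChar_mul_ne_one hψ₁ hL0
  have hsr : valuation F s ≤ valuation F (ϖ : F) ^ r :=
    hs.trans (inv_le_of_inv_le₀ (pow_pos hpos r) (le_mul_valuation_of_lt hϖ hXg))
  have hsX : EntriesLE (valuation F (ϖ : F) ^ r) (s • X) := by
    simpa using EntriesLE.smul hsr hX
  obtain ⟨k₀, hk₀, hk₀X⟩ := exists_mem_congruenceSet hϖ hr1 hsX
  have hk₀det : Matrix.GeneralLinearGroup.det k₀ = 1 := Units.ext (by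
    change (k₀ : Matrix (Fin n) (Fin n) F).det = 1
    rw [hk₀X, hXdet])
  have hudet : Matrix.det ((d⁻¹ * k₀ * d : GL (Fin n) F) : Matrix (Fin n) (Fin n) F) = 1 := by
    have h1 : Matrix.GeneralLinearGroup.det (d⁻¹ * k₀ * d) = 1 := by
      rw [map_mul, map_mul, hk₀det, mul_one, map_inv, inv_mul_cancel]
    exact congrArg Units.val h1
  let u : Matrix.SpecialLinearGroup (Fin n) F := ⟨_, hudet⟩
  have hu : Matrix.SpecialLinearGroup.toGL u = d⁻¹ * k₀ * d := Units.ext rfl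
  have huU : u ∈ U := by
    change d * Matrix.SpecialLinearGroup.toGL u * d⁻¹ ∈ congruenceSet F n r
    rw [hu]
    convert hk₀ using 1
    group
  refine setIntegral_eq_zero_of_translate (hU.preimage (continuous_mul_const h₀⁻¹)).measurableSet
    hsψ (k := u) (fun h => ?_) fun h hh => ?_
  · change u * h * h₀⁻¹ ∈ U ↔ h * h₀⁻¹ ∈ U
    rw [mul_assoc, U.mul_mem_cancel_left huU]
  · obtain ⟨k, hk, hkh⟩ := hcoset hh
    have huh : d * Matrix.SpecialLinearGroup.toGL (u * h) = k₀ * (k * g₀) := by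
      rw [map_mul, hu, ← hkh]
      group
    have htr : Matrix.trace (((k₀ * (k * g₀) : GL (Fin n) F) : Matrix (Fin n) (Fin n) F) -
        ((k * g₀ : GL (Fin n) F) : Matrix (Fin n) (Fin n) F)) = s * L +
        ((s • X) * ((k - 1 : Matrix (Fin n) (Fin n) F) * g₀)).trace := by
      simp only [Units.val_mul, hk₀X]
      rw [add_mul, one_mul, add_sub_cancel_left, sub_mul, one_mul, mul_sub, Matrix.trace_sub,
        Matrix.smul_mul s X (g₀ : Matrix (Fin n) (Fin n) F), Matrix.trace_smul, smul_eq_mul, ← hL,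
        add_sub_cancel]
    -- The factors `sX` and `k - 1` lie in `𝔭^r` and `g₀` in `𝔭^{-(ℓ+1)}`, so `2r ≥ ℓ + 1` makes the
    -- product integral.
    have hsmall : valuation F
        ((s • X) * ((k - 1 : Matrix (Fin n) (Fin n) F) * g₀)).trace ≤ 1 := by
      refine (hsX.mul (((mem_congruenceSet_iff hϖ r k).1 hk).mul hT.1)).trace.trans ?_
      rw [← mul_assoc, ← pow_add, ← div_eq_mul_inv, div_le_one₀ (pow_pos hpos _)]
      exact pow_le_pow_right_of_le_one' hlt.le hr2
    rw [huh, hkh, Set.indicator_of_mem ((hstab hk₀ _).2 ((hstab hk _).2 hT)),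
      Set.indicator_of_mem ((hstab hk _).2 hT), hφ k₀ (congruenceSet_antitone hϖ hrm hk₀),
      phiGJ_eq_mul (valuation_det_mul_of_mem_congruenceSet hϖ hr1 hk₀ (k * g₀)), htr,
      AddChar.map_add_eq_mul, hψ₀ ⟨_, hsmall⟩, mul_one, mul_assoc]

theorem exists_fiberIntegral_stable {φ : GL (Fin n) F → ℂ} {m : ℕ} (hm : 1 ≤ m)
    (hφ : ∀ k ∈ congruenceSet F n m, ∀ g, φ (k * g) = φ g) (c : ValueGroupWithZero F) :
    ∃ ℓ₀, 1 ≤ ℓ₀ ∧ ∀ x : Fˣ, valuation F (x : F) ≤ c → ∀ ℓ, ℓ₀ ≤ ℓ →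
      fiberIntegral μG μS ψ φ ℓ x = fiberIntegral μG μS ψ φ ℓ₀ x := by
  have hlt := valuation_uniformizer_lt_one hϖ
  obtain ⟨k, hk⟩ := exists_pow_mul_le_one hϖ c
  -- The exponent `k` gives `|x ϖ^{ℓ+1}| < 1` whenever `|x| ≤ c`; `2 * m` ensures that `φ` is
  -- invariant at the level used on the shells.
  refine ⟨max k (2 * m), by omega, fun x hx ℓ hℓ => ?_⟩
  induction ℓ, hℓ using Nat.le_induction with
  | base => rfl
  | succ ℓ hℓ ih =>
    rw [← ih]
    refine fiberIntegral_succ hϖ hψ₀ hψ₁ μG μS hm hφ (by omega) ?_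
    calc _ ≤ c * (valuation F (ϖ : F) ^ k * valuation F (ϖ : F)) := by
          refine mul_le_mul' hx ?_
          rw [← pow_succ]
          exact pow_le_pow_right_of_le_one' hlt.le (by omega)
      _ = valuation F (ϖ : F) ^ k * c * valuation F (ϖ : F) := by rw [← mul_assoc, mul_comm c]
      _ ≤ 1 * valuation F (ϖ : F) := mul_le_mul' hk le_rfl
      _ < 1 := by rwa [one_mul]

omit [μS.IsHaarMeasure] in
-- The base points of the two fibers differ by left multiplication by `diag(y/x, 1, …, 1)`, which
-- leaves the integrand unchanged.
theorem fiberIntegral_locally_constant {φ : GL (Fin n) F → ℂ} {m : ℕ}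
    (hφ : ∀ k ∈ congruenceSet F n m, ∀ g, φ (k * g) = φ g) {ℓ : ℕ} (hℓ : 1 ≤ ℓ) {x y : Fˣ}
    (hxy : valuation F ((y / x : Fˣ) - 1 : F) ≤ valuation F (ϖ : F) ^ max ℓ m) :
    fiberIntegral μG μS ψ φ ℓ y = fiberIntegral μG μS ψ φ ℓ x := by
  have hmul : diagElt n y = diagElt n (y / x) * diagElt n x := by
    refine Units.ext ?_
    change Matrix.diagonal _ = Matrix.diagonal _ * Matrix.diagonal _
    rw [Matrix.diagonal_mul_diagonal]
    congr 1
    funext i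
    by_cases hi : i = 0
    · subst hi
      simp [Units.val_div_eq_div_val]
    · simp [hi]
  have hmem : diagElt n (y / x) ∈ congruenceSet F n (max ℓ m) := by
    rw [mem_congruenceSet_iff hϖ]
    intro i j
    change valuation F ((Matrix.diagonal _ : Matrix (Fin n) (Fin n) F) i j -
      (1 : Matrix (Fin n) (Fin n) F) i j) ≤ _
    by_cases hij : i = j
    · subst hij
      by_cases hi : i = 0
      · subst hi
        simpa using hxy
      · simp [hi]
    · simp [hij]
  rw [fiberIntegral_eq hϖ hψ₀ hψ₁ μG μS hφ hℓ, fiberIntegral_eq hϖ hψ₀ hψ₁ μG μS hφ hℓ, hmul]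
  refine integral_congr_ae (Eventually.of_forall fun h => ?_)
  simp only [mul_assoc]
  exact fiberIntegrand_mul_left hϖ hψ₀ hψ₁ μG hφ hℓ hmem _

end Fibers

/-! ### Boundedness of compact subsets of `Fˣ`, and the main theorem. -/

section CompactSets

variable {F : Type*} [Field F] [ValuativeRel F] [TopologicalSpace F]
  [IsNonarchimedeanLocalField F]

theorem isOpen_units_valuation_le {c : ValueGroupWithZero F} (hc : c ≠ 0) :
    IsOpen {x : Fˣ | valuation F (x : F) ≤ c} := by
  have h := (isOpen_valuation_sub_le (0 : F) hc).preimage Units.continuous_val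
  simp only [sub_zero] at h
  exact h

/-- The sets `|x| ≤ |y|` form a directed open cover, so one of them contains `N`. -/
theorem exists_valuation_le_of_isCompact {N : Set Fˣ} (hN : IsCompact N) :
    ∃ c : ValueGroupWithZero F, ∀ x ∈ N, valuation F (x : F) ≤ c := by
  obtain ⟨y, hy⟩ := hN.elim_directed_cover
    (fun y : Fˣ => {x : Fˣ | valuation F (x : F) ≤ valuation F (y : F)})
    (fun y => isOpen_units_valuation_le ((valuation F).ne_zero_iff.2 y.ne_zero))
    (fun x _ => Set.mem_iUnion.2 ⟨x, le_refl (valuation F (x : F))⟩) fun y z => by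
      rcases le_total (valuation F (y : F)) (valuation F (z : F)) with h | h
      · exact ⟨z, fun x (hx : valuation F (x : F) ≤ _) => hx.trans h, fun x hx => hx⟩
      · exact ⟨y, fun x hx => hx, fun x (hx : valuation F (x : F) ≤ _) => hx.trans h⟩
  exact ⟨valuation F (y : F), fun x hx => hy hx⟩

end CompactSets

end PiKernel

theorem mainTheorem7 {F : Type*} [Field F] [CharZero F] [ValuativeRel F] [TopologicalSpace F]
    [IsNonarchimedeanLocalField F] (n : ℕ) [NeZero n]
    [MeasurableSpace (GL (Fin n) F)] [BorelSpace (GL (Fin n) F)]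
    [MeasurableSpace (Matrix.SpecialLinearGroup (Fin n) F)]
    [BorelSpace (Matrix.SpecialLinearGroup (Fin n) F)]
    (μG : Measure (GL (Fin n) F)) [μG.IsHaarMeasure]
    (μS : Measure (Matrix.SpecialLinearGroup (Fin n) F)) [μS.IsHaarMeasure]
    (ψ : AddChar F Circle) (hψ : PiKernel.IsUnramifiedChar ψ)
    {V : Type*} [AddCommGroup V] [Module ℂ V] (ρ : Representation ℂ (GL (Fin n) F) V)
    (hsmooth : PiKernel.IsSmoothRep ρ) (hirr : ρ.IsIrreducible)
    (φ : GL (Fin n) F → ℂ) (hφ : φ ∈ PiKernel.contragredientCoeffs ρ) (hφ1 : φ 1 = 1) :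
    -- the convolutions and the fiber integrals converge absolutely
    (∀ ℓ : ℕ, 1 ≤ ℓ →
      (∀ g : GL (Fin n) F, Integrable (fun h : GL (Fin n) F =>
        PiKernel.phiGJ ψ h * PiKernel.check (PiKernel.approxDelta μG ℓ) (h⁻¹ * g)) μG) ∧
      (∀ x : Fˣ, Integrable (fun g : PiKernel.DetFiber n x =>
        PiKernel.fiberIntegrand μG ψ φ ℓ g.1) (PiKernel.fiberMeasure μS x))) ∧
    -- the limit defining the kernel function exists
    (∀ x : Fˣ, Tendsto (fun ℓ : ℕ => PiKernel.fiberIntegral μG μS ψ φ ℓ x) atTop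
      (𝓝 (PiKernel.kernel μG μS ψ φ x))) ∧
    -- it is attained at a finite stage, uniformly on compact open sets
    (∀ N : Set Fˣ, IsCompact N → IsOpen N → ∃ ℓ₀ : ℕ, ∀ ℓ : ℕ, ℓ₀ ≤ ℓ → ∀ x ∈ N,
      PiKernel.fiberIntegral μG μS ψ φ ℓ x = PiKernel.kernel μG μS ψ φ x) ∧
    -- the kernel function is smooth, that is, locally constant
    IsLocallyConstant (PiKernel.kernel μG μS ψ φ) := by
  obtain ⟨hψ₀, ϖ, hϖ, hψ₁⟩ := hψ
  obtain ⟨m, hm, hφK⟩ := PiKernel.exists_left_invariant_of_mem_contragredientCoeffs hϖ hsmooth hφ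
  have hstable (c : ValueGroupWithZero F) : ∃ ℓ₀, 1 ≤ ℓ₀ ∧
      ∀ x : Fˣ, valuation F (x : F) ≤ c → ∀ ℓ, ℓ₀ ≤ ℓ →
        PiKernel.fiberIntegral μG μS ψ φ ℓ x = PiKernel.kernel μG μS ψ φ x := by
    obtain ⟨ℓ₀, hℓ₀, h⟩ := PiKernel.exists_fiberIntegral_stable hϖ hψ₀ hψ₁ μG μS hm hφK c
    refine ⟨ℓ₀, hℓ₀, fun x hx ℓ hℓ => ?_⟩
    have hlim : Tendsto (fun ℓ : ℕ => PiKernel.fiberIntegral μG μS ψ φ ℓ x) atTop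
        (𝓝 (PiKernel.fiberIntegral μG μS ψ φ ℓ₀ x)) :=
      tendsto_const_nhds.congr' ((eventually_ge_atTop ℓ₀).mono fun ℓ hℓ => (h x hx ℓ hℓ).symm)
    rw [h x hx ℓ hℓ, PiKernel.kernel, hlim.limUnder_eq]
  refine ⟨fun ℓ hℓ => ⟨PiKernel.integrable_conv_integrand hϖ hψ₀ μG hℓ,
    PiKernel.integrable_fiberIntegrand hϖ hψ₀ hψ₁ μG μS hφK hℓ⟩, fun x => ?_,
    fun N hN _ => ?_, (IsLocallyConstant.iff_eventually_eq _).2 fun x => ?_⟩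
  · obtain ⟨ℓ₀, -, h⟩ := hstable (valuation F (x : F))
    exact tendsto_const_nhds.congr'
      ((eventually_ge_atTop ℓ₀).mono fun ℓ hℓ => (h x le_rfl ℓ hℓ).symm)
  · obtain ⟨c, hc⟩ := PiKernel.exists_valuation_le_of_isCompact hN
    obtain ⟨ℓ₀, -, h⟩ := hstable c
    exact ⟨ℓ₀, fun ℓ hℓ x hx => h x (hc x hx) ℓ hℓ⟩
  -- On the open set `|y| ≤ |x|` a single `ℓ₀` computes the kernel, so local constancy of that one
  -- fiber integral suffices.
  · obtain ⟨ℓ₀, hℓ₀, h⟩ := hstable (valuation F (x : F))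
    have hx0 : valuation F (x : F) ≠ 0 := (valuation F).ne_zero_iff.2 x.ne_zero
    have hne := pow_ne_zero (max ℓ₀ m) (PiKernel.valuation_uniformizer_ne_zero hϖ)
    have h1 := ((PiKernel.isOpen_valuation_sub_le (1 : F) hne).preimage
      (Units.continuous_val.comp (continuous_id.div_const x))).mem_nhds
        (show x ∈ _ by simp)
    filter_upwards [h1, (PiKernel.isOpen_units_valuation_le hx0).mem_nhds
      (le_refl (valuation F (x : F)))] with y hy hyx
    rw [← h x le_rfl ℓ₀ le_rfl, ← h y hyx ℓ₀ le_rfl]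
    exact PiKernel.fiberIntegral_locally_constant hϖ hψ₀ hψ₁ μG μS hφK hℓ₀ hy
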